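/- Let $\alpha>1$ be real and let $p\ge 0$ be an integer. For a real $s\ge 0$ let $H^{s}(\mathbb{R})$ be the Sobolev space of real-valued functions $f\in L^2(\mathbb{R})$ with $\|f\|_{H^s}=\|(1+|\xi|^2)^{s/2}\hat f\|_{L^2}<\infty$, and let $D^{\alpha}$ be the Fourier multiplier with symbol $|\xi|^{\alpha}$. For $T\in(0,\infty]$ and $u_0\in H^{\alpha/2}(\mathbb{R})$, a function $u\in C([0,T);H^{\alpha/2}(\mathbb{R}))$ is called a solution on $[0,T)$ of the Cauchy problem $$u_t+u_x+\tfrac12\,(u^{p+1})_x+\tfrac34\,D^{\alpha}u_x+\tfrac54\,D^{\alpha}u_t=0,\qquad u(\cdot,0)=u_0,$$ if $u(0)=u_0$ and, for every Schwartz function $\varphi$ on $\mathbb{R}$ and every $t\in[0,T)$, the function $t\mapsto\int_{\mathbb{R}}u(t)\,(\varphi+\tfrac54D^{\alpha}\varphi)\,dx$ is differentiable at $t$ (from the right at $t=0$) with $$\frac{d}{dt}\int_{\mathbb{R}}u(t)\,\big(\varphi+\tfrac54D^{\alpha}\varphi\big)\,dx=\int_{\mathbb{R}}\big(u(t)+\tfrac12u(t)^{p+1}\big)\varphi'\,dx+\tfrac34\int_{\mathbb{R}}u(t)\,D^{\alpha}\varphi'\,dx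 .$$ Theorem. For each $u_0\in H^{\alpha/2}(\mathbb{R})$ the maximal time of existence of the solution is $+\infty$: there is a unique solution $u\in C([0,\infty);H^{\alpha/2}(\mathbb{R}))$ on $[0,\infty)$ of the Cauchy problem, and for every $T>0$ every solution $v\in C([0,T);H^{\alpha/2}(\mathbb{R}))$ on $[0,T)$ with the same initial value $u_0$ is the restriction of $u$ to $[0,T)$. -/

import Mathlib

open MeasureTheory
open scoped FourierTransform SchwartzMap

noncomputable section

namespace GfBBM

/-- The `L²`-Fourier transform of a real-valued function in `L²(ℝ)`.
Mathlib's convention is `f̂(ξ) = ∫ f(x) e^{-2πixξ} dx`, so the frequency variable of the convention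
`∫ f(x) e^{-ixξ} dx` is `2πξ`. -/
def fourierL2 (f : Lp ℝ 2 (volume : Measure ℝ)) : Lp ℂ 2 (volume : Measure ℝ) :=
  𝓕 (Complex.ofRealCLM.compLp f)

theorem fourierL2_add (f g : Lp ℝ 2 (volume : Measure ℝ)) :
    fourierL2 (f + g) = fourierL2 f + fourierL2 g := by
  have h : Complex.ofRealCLM.compLp (f + g)
      = Complex.ofRealCLM.compLp f + Complex.ofRealCLM.compLp g :=
    (Complex.ofRealCLM.compLpₗ 2 (volume : Measure ℝ)).map_add f g
  unfold fourierL2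
  rw [h]
  exact FourierTransform.fourier_add _ _

theorem fourierL2_smul (c : ℝ) (f : Lp ℝ 2 (volume : Measure ℝ)) :
    fourierL2 (c • f) = c • fourierL2 f := by
  have h : Complex.ofRealCLM.compLp (c • f) = c • Complex.ofRealCLM.compLp f :=
    (Complex.ofRealCLM.compLpₗ 2 (volume : Measure ℝ)).map_smul c f
  have h2 : ∀ g : Lp ℂ 2 (volume : Measure ℝ), c • g = (c : ℂ) • g := fun g => by
    rw [← algebraMap_smul ℂ c g]; rfl
  unfold fourierL2
  rw [h, h2, h2]
  exact FourierTransform.fourier_smul _ _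

theorem fourierL2_injective : Function.Injective fourierL2 := by
  intro f g h
  have h1 : Complex.ofRealCLM.compLp f = Complex.ofRealCLM.compLp g :=
    (Lp.fourierTransformₗᵢ ℝ ℂ).injective h
  apply Lp.ext
  filter_upwards [Complex.ofRealCLM.coeFn_compLp f, Complex.ofRealCLM.coeFn_compLp g] with x hf hg
  rw [h1, hg] at hf
  simpa using hf.symm

/-- The function `(1 + |2πξ|²)^{s/2} f̂(ξ)`. -/
def weightedFourier (s : ℝ) (f : Lp ℝ 2 (volume : Measure ℝ)) (ξ : ℝ) : ℂ :=
  (((1 + (2 * Real.pi * ξ) ^ 2) ^ (s / 2) : ℝ) : ℂ) * fourierL2 f ξ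

theorem weightedFourier_add (s : ℝ) (f g : Lp ℝ 2 (volume : Measure ℝ)) :
    weightedFourier s (f + g) =ᵐ[volume] weightedFourier s f + weightedFourier s g := by
  filter_upwards [Lp.coeFn_add (fourierL2 f) (fourierL2 g)] with ξ h
  simp only [weightedFourier, fourierL2_add, Pi.add_apply] at h ⊢
  rw [h]; ring

theorem weightedFourier_smul (s c : ℝ) (f : Lp ℝ 2 (volume : Measure ℝ)) :
    weightedFourier s (c • f) =ᵐ[volume] c • weightedFourier s f := by
  filter_upwards [Lp.coeFn_smul c (fourierL2 f)] with ξ h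
  simp only [weightedFourier, fourierL2_smul, Pi.smul_apply, Complex.real_smul] at h ⊢
  rw [h]; ring

theorem weightedFourier_zero (s : ℝ) :
    weightedFourier s 0 =ᵐ[volume] (0 : ℝ → ℂ) := by
  have h := weightedFourier_smul s 0 0
  simpa using h

/-- The functions of `H^s(ℝ)` (real-valued, `s ≥ 0`) as a subspace of `L²(ℝ)`. -/
def sobolevSubmodule (s : ℝ) : Submodule ℝ (Lp ℝ 2 (volume : Measure ℝ)) where
  carrier := {f | MemLp (weightedFourier s f) 2 volume}
  zero_mem' := (memLp_congr_ae (weightedFourier_zero s)).2 MemLp.zero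
  add_mem' {f g} hf hg := (memLp_congr_ae (weightedFourier_add s f g)).2 (hf.add hg)
  smul_mem' c f hf := (memLp_congr_ae (weightedFourier_smul s c f)).2 (hf.const_smul c)

/-- The Sobolev space `H^s(ℝ)` (`s ≥ 0`) of real-valued functions. It is a type of its own, since
its norm is not the `L²` norm that `sobolevSubmodule s` inherits. -/
def Sobolev (s : ℝ) : Type := ↥(sobolevSubmodule s)

namespace Sobolev

variable {s : ℝ}

instance : AddCommGroup (Sobolev s) := inferInstanceAs (AddCommGroup ↥(sobolevSubmodule s))

instance : Module ℝ (Sobolev s) := inferInstanceAs (Module ℝ ↥(sobolevSubmodule s))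

/-- The underlying element of `L²(ℝ)`. -/
def toL2 (f : Sobolev s) : Lp ℝ 2 (volume : Measure ℝ) := f.1

theorem memLp_weightedFourier (f : Sobolev s) : MemLp (weightedFourier s f.toL2) 2 volume := f.2

variable (s) in
/-- The map `f ↦ (1 + |2πξ|²)^{s/2} f̂(ξ)` from `H^s(ℝ)` to `L²(ℝ; ℂ)`. -/
def weighted : Sobolev s →ₗ[ℝ] Lp ℂ 2 (volume : Measure ℝ) where
  toFun f := MemLp.toLp (weightedFourier s f.toL2) f.memLp_weightedFourier
  map_add' f g := (MemLp.toLp_congr (f + g).memLp_weightedFourier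
      (f.memLp_weightedFourier.add g.memLp_weightedFourier)
      (weightedFourier_add s f.toL2 g.toL2)).trans (MemLp.toLp_add _ _)
  map_smul' c f := (MemLp.toLp_congr (c • f).memLp_weightedFourier
      (f.memLp_weightedFourier.const_smul c)
      (weightedFourier_smul s c f.toL2)).trans (MemLp.toLp_const_smul c _)

theorem weighted_injective : Function.Injective (weighted s) := by
  intro f g h
  have h1 : weightedFourier s f.toL2 =ᵐ[volume] weightedFourier s g.toL2 :=
    (MemLp.toLp_eq_toLp_iff f.memLp_weightedFourier g.memLp_weightedFourier).1 h
  apply Subtype.ext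
  apply fourierL2_injective
  apply Lp.ext
  filter_upwards [h1] with ξ hξ
  have hpos : (0 : ℝ) < (1 + (2 * Real.pi * ξ) ^ 2) ^ (s / 2) := by positivity
  exact mul_left_cancel₀ (Complex.ofReal_ne_zero.2 hpos.ne') hξ

/-- The norm `‖f‖_{H^s} = ‖(1 + |2πξ|²)^{s/2} f̂‖_{L²}`. -/
instance : NormedAddCommGroup (Sobolev s) :=
  NormedAddCommGroup.induced (Sobolev s) (Lp ℂ 2 (volume : Measure ℝ)) (weighted s)
    weighted_injective

instance : NormedSpace ℝ (Sobolev s) :=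
  NormedSpace.induced ℝ (Sobolev s) (Lp ℂ 2 (volume : Measure ℝ)) (weighted s)

end Sobolev

/-- The operator `D^α = (-∂ₓ²)^{α/2}` on Schwartz functions, i.e. the Fourier multiplier with
symbol `|ξ|^α` (which is `|2πξ|^α` in Mathlib's convention). -/
def fracD (α : ℝ) (φ : 𝓢(ℝ, ℂ)) : ℝ → ℂ :=
  𝓕⁻ fun ξ : ℝ => ((|2 * Real.pi * ξ| ^ α : ℝ) : ℂ) * 𝓕 (φ : ℝ → ℂ) ξ

/-- `u ∈ C(J; H^r(ℝ))` is a solution on the time interval `J` (which contains `0`) of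
`u_t + u_x + (1/2) (u^{p+1})_x + (3/4) D^α u_x + (5/4) D^α u_t = 0`, `u(0) = u₀`.
The equation holds for each time `t ∈ J` in the sense of tempered distributions in `x`: spatial
derivatives and `D^α` are moved to the test function `φ`, so that it reads
`d/dt ⟨u, φ + (5/4) D^α φ⟩ = ⟨u + (1/2) u^{p+1}, φ'⟩ + (3/4) ⟨u, D^α φ'⟩`. -/
structure IsSolutionOn {r : ℝ} (α : ℝ) (p : ℕ) (u₀ : Sobolev r) (J : Set ℝ)
    (u : ℝ → Sobolev r) : Prop where
  continuousOn : ContinuousOn u J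
  initial : u 0 = u₀
  equation : ∀ φ : 𝓢(ℝ, ℂ), ∀ t ∈ J,
    HasDerivWithinAt
      (fun τ : ℝ => ∫ x : ℝ, ((u τ).toL2 x : ℂ) * (φ x + 5 / 4 * fracD α φ x))
      ((∫ x : ℝ, (((u t).toL2 x : ℂ) + 1 / 2 * ((u t).toL2 x : ℂ) ^ (p + 1)) * deriv φ x)
        + 3 / 4 * ∫ x : ℝ, ((u t).toL2 x : ℂ) * fracD α (SchwartzMap.derivCLM ℂ ℂ φ) x)
      J t

end GfBBM

end

/-! On the Fourier side put g = (1 + (5/4)|2πξ|^α)^{1/2} û. The equation becomes g_t = -iθg + νN(g),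
with θ = `disp α` real, ν = `nl α`, and N(g) = `npow α p g` representing u^{p+1}. As α > 1, ν is
bounded, so the derivative on the nonlinear term costs nothing. For the same reason 1/`wt α` is
integrable, so H^{α/2} is an algebra (`exists_norm_prod_le`) and N is Lipschitz on balls. Only θ,
which grows linearly, is unbounded. The unitary group absorbs it: w = e^{itθ}g solves w' = `field α
p t w`, an ordinary differential equation in L² whose field is Lipschitz on balls uniformly in t.

The solution is global because the norm is conserved: ‖g‖² is the energy ∫ u² + (5/4)|D^{α/2}u|²,
and for real u the product ⟪w, w'⟫ equals (1/2)∫ u_x u^{p+1} = 0, the integral of a derivative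
(`inner_nl_npow`). Hence neither the size of u₀ nor the power p matters (`exists_global_solution`).

For uniqueness, a weak solution gives only scalar derivatives against test functions, and g need not
be differentiable in L². The factor 1/(1+θ²) makes iθ bounded and e^{itθ} differentiable in operator
norm. The damped test functions separate points (`eq_zero_of_inner_test`), so weak derivatives of a
continuous curve become strong ones by the fundamental theorem of calculus
(`hasDerivWithinAt_of_separating`). Thus e^{itθ}g solves the differential equation for every weak
solution (`IsSolutionOn.hasDerivWithinAt`), and uniqueness for Lipschitz fields applies. The same
damping yields the weak equation for the solution constructed. -/

noncomputable section

open Filter Topology Set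
open scoped ComplexConjugate InnerProductSpace ENNReal NNReal

namespace GfBBM

/-! ### Multiplication operators on `L²` and the unitary group of a real symbol. -/

section

/-- The complex Hilbert space `L²(ℝ; ℂ)`. -/
abbrev L2 : Type := Lp ℂ 2 (volume : Measure ℝ)

/-- Bounded measurable symbols. -/
structure BddSymbol (a : ℝ → ℂ) : Prop where
  measurable : Measurable a
  bound : ∃ C, ∀ ξ, ‖a ξ‖ ≤ C

theorem memLp_mul_of_bound {a g : ℝ → ℂ} {C : ℝ} (ha : Measurable a) (hC : ∀ ξ, ‖a ξ‖ ≤ C)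
    (hg : MemLp g 2 volume) : MemLp (fun ξ => a ξ * g ξ) 2 volume :=
  MemLp.of_le_mul (c := C) hg (ha.aestronglyMeasurable.mul hg.1) (ae_of_all _ fun ξ => by
    rw [norm_mul]; exact mul_le_mul_of_nonneg_right (hC ξ) (norm_nonneg _))

theorem BddSymbol.memLp {a : ℝ → ℂ} (ha : BddSymbol a) (g : L2) :
    MemLp (fun ξ => a ξ * g ξ) 2 volume :=
  memLp_mul_of_bound ha.measurable ha.bound.choose_spec (Lp.memLp g)

/-- Multiplication by a bounded symbol, as a linear map. -/
def BddSymbol.mulLin {a : ℝ → ℂ} (ha : BddSymbol a) : L2 →ₗ[ℂ] L2 where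
  toFun g := (ha.memLp g).toLp _
  map_add' f g := by
    apply Lp.ext
    filter_upwards [(ha.memLp (f + g)).coeFn_toLp, Lp.coeFn_add f g,
      Lp.coeFn_add ((ha.memLp f).toLp _) ((ha.memLp g).toLp _),
      (ha.memLp f).coeFn_toLp, (ha.memLp g).coeFn_toLp] with ξ h1 h2 h3 h4 h5
    rw [h1, h3, h2, Pi.add_apply, Pi.add_apply, h4, h5, mul_add]
  map_smul' c g := by
    apply Lp.ext
    filter_upwards [(ha.memLp (c • g)).coeFn_toLp, Lp.coeFn_smul c g,
      Lp.coeFn_smul c ((ha.memLp g).toLp _), (ha.memLp g).coeFn_toLp] with ξ h1 h2 h3 h4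
    rw [h1, RingHom.id_apply, h3, h2, Pi.smul_apply, Pi.smul_apply, h4, smul_eq_mul, smul_eq_mul]
    ring

theorem BddSymbol.norm_mulLin_le {a : ℝ → ℂ} (ha : BddSymbol a) {C : ℝ} (hC : ∀ ξ, ‖a ξ‖ ≤ C)
    (g : L2) : ‖ha.mulLin g‖ ≤ C * ‖g‖ := by
  apply Lp.norm_le_mul_norm_of_ae_le_mul
  filter_upwards [(ha.memLp g).coeFn_toLp] with ξ h
  change ‖(ha.memLp g).toLp _ ξ‖ ≤ _
  rw [h, norm_mul]
  exact mul_le_mul_of_nonneg_right (hC ξ) (norm_nonneg _)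

open Classical in
/-- Multiplication by the symbol `a` on `L²`, for a bounded measurable `a`. -/
def mulOp (a : ℝ → ℂ) : L2 →L[ℂ] L2 :=
  if ha : BddSymbol a then
    ha.mulLin.mkContinuous ha.bound.choose (ha.norm_mulLin_le ha.bound.choose_spec)
  else 0

variable {a c : ℝ → ℂ}

theorem mulOp_apply (ha : BddSymbol a) (g : L2) : mulOp a g = (ha.memLp g).toLp _ := by
  rw [mulOp, dif_pos ha]; rfl

theorem coeFn_mulOp (ha : BddSymbol a) (g : L2) : mulOp a g =ᵐ[volume] fun ξ => a ξ * g ξ := by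
  rw [mulOp_apply ha]; exact (ha.memLp g).coeFn_toLp

theorem norm_mulOp_apply_le (ha : BddSymbol a) {C : ℝ} (hC : ∀ ξ, ‖a ξ‖ ≤ C) (g : L2) :
    ‖mulOp a g‖ ≤ C * ‖g‖ := by
  rw [mulOp_apply ha]; exact ha.norm_mulLin_le hC g

theorem mulOp_ext {g h : L2} (ha : BddSymbol a) (hgh : (fun ξ => a ξ * g ξ) =ᵐ[volume] h) :
    mulOp a g = h :=
  Lp.ext ((coeFn_mulOp ha g).trans hgh)

theorem BddSymbol.mul (ha : BddSymbol a) (hc : BddSymbol c) : BddSymbol (fun ξ => a ξ * c ξ) := by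
  obtain ⟨A, hA⟩ := ha.bound
  obtain ⟨B, hB⟩ := hc.bound
  refine ⟨ha.measurable.mul hc.measurable, A * B, fun ξ => ?_⟩
  rw [norm_mul]
  exact mul_le_mul (hA ξ) (hB ξ) (norm_nonneg _) ((norm_nonneg _).trans (hA ξ))

theorem BddSymbol.conj (ha : BddSymbol a) : BddSymbol (fun ξ => conj (a ξ)) := by
  obtain ⟨A, hA⟩ := ha.bound
  exact ⟨Complex.continuous_conj.measurable.comp ha.measurable, A, fun ξ => by simpa using hA ξ⟩

theorem mulOp_mulOp (ha : BddSymbol a) (hc : BddSymbol c) (g : L2) :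
    mulOp a (mulOp c g) = mulOp (fun ξ => a ξ * c ξ) g := by
  refine mulOp_ext ha ?_
  filter_upwards [coeFn_mulOp hc g, coeFn_mulOp (ha.mul hc) g] with ξ h1 h2
  rw [h1, h2, mul_assoc]

theorem mulOp_one (g : L2) : mulOp (fun _ => 1) g = g :=
  mulOp_ext ⟨measurable_const, 1, fun _ => by simp⟩ (ae_of_all _ fun ξ => one_mul _)

theorem inner_mulOp_left (ha : BddSymbol a) (g h : L2) :
    ⟪mulOp a g, h⟫_ℂ = ⟪g, mulOp (fun ξ => conj (a ξ)) h⟫_ℂ := by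
  rw [L2.inner_def, L2.inner_def]
  apply integral_congr_ae
  filter_upwards [coeFn_mulOp ha g, coeFn_mulOp ha.conj h] with ξ h1 h2
  simp only [h1, h2, RCLike.inner_apply, map_mul]
  ring

theorem mulOp_injective (ha : BddSymbol a) (h0 : ∀ ξ, a ξ ≠ 0) : Function.Injective (mulOp a) := by
  intro f g h
  apply Lp.ext
  filter_upwards [coeFn_mulOp ha f, coeFn_mulOp ha g] with ξ h1 h2
  rw [h, h2] at h1
  exact (mul_left_cancel₀ (h0 ξ) h1).symm

theorem norm_sq_eq_integral (g : L2) : ‖g‖ ^ 2 = ∫ ξ, ‖g ξ‖ ^ 2 := by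
  have h := L2.inner_def (𝕜 := ℂ) g g
  rw [inner_self_eq_norm_sq_to_K] at h
  have h2 : ∀ ξ, ⟪g ξ, g ξ⟫_ℂ = ((‖g ξ‖ ^ 2 : ℝ) : ℂ) := fun ξ => by
    rw [inner_self_eq_norm_sq_to_K]; norm_cast
  simp only [h2] at h
  have h3 := h.trans (integral_ofReal (𝕜 := ℂ) (f := fun ξ => ‖g ξ‖ ^ 2))
  exact_mod_cast h3

theorem integrable_norm_sq (g : L2) : Integrable (fun ξ => ‖g ξ‖ ^ 2) :=
  (memLp_two_iff_integrable_sq_norm (Lp.aestronglyMeasurable g)).1 (Lp.memLp g)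

/-- Strong convergence of multiplication operators with bounded, pointwise convergent symbols. -/
theorem tendsto_mulOp {ι : Type*} {l : Filter ι} [l.IsCountablyGenerated] {s : ι → ℝ → ℂ}
    (hs : ∀ i, BddSymbol (s i)) (ha : BddSymbol a) {C : ℝ} (hC : ∀ i ξ, ‖s i ξ‖ ≤ C)
    (hlim : ∀ ξ, Tendsto (fun i => s i ξ) l (𝓝 (a ξ))) (g : L2) :
    Tendsto (fun i => mulOp (s i) g) l (𝓝 (mulOp a g)) := by
  rw [tendsto_iff_norm_sub_tendsto_zero]
  obtain ⟨A, hA⟩ := ha.bound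
  have key : Tendsto (fun i => ∫ ξ, (‖s i ξ - a ξ‖ * ‖g ξ‖) ^ 2) l (𝓝 (∫ _ξ : ℝ, (0 : ℝ))) := by
    refine tendsto_integral_filter_of_dominated_convergence
      (fun ξ => (C + A) ^ 2 * ‖g ξ‖ ^ 2) ?_ ?_ ((integrable_norm_sq g).const_mul _) ?_
    · refine Eventually.of_forall fun i => ?_
      exact (((((hs i).measurable.sub ha.measurable).norm).aestronglyMeasurable).mul
        (Lp.aestronglyMeasurable g).norm).pow 2
    · refine Eventually.of_forall fun i => ae_of_all _ fun ξ => ?_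
      have h1 : ‖s i ξ - a ξ‖ ≤ C + A := (norm_sub_le _ _).trans (add_le_add (hC i ξ) (hA ξ))
      rw [Real.norm_of_nonneg (by positivity), mul_pow]
      gcongr
    · refine ae_of_all _ fun ξ => ?_
      have h1 : Tendsto (fun i => ‖s i ξ - a ξ‖) l (𝓝 0) :=
        tendsto_iff_norm_sub_tendsto_zero.1 (hlim ξ)
      simpa using (h1.mul_const ‖g ξ‖).pow 2
  have h2 : ∀ i, ‖mulOp (s i) g - mulOp a g‖ = Real.sqrt (∫ ξ, (‖s i ξ - a ξ‖ * ‖g ξ‖) ^ 2) := by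
    intro i
    rw [← Real.sqrt_sq (norm_nonneg (mulOp (s i) g - mulOp a g)), norm_sq_eq_integral]
    congr 1
    apply integral_congr_ae
    filter_upwards [coeFn_mulOp (hs i) g, coeFn_mulOp ha g,
      Lp.coeFn_sub (mulOp (s i) g) (mulOp a g)] with ξ h1 h2 h3
    rw [h3, Pi.sub_apply, h1, h2, ← sub_mul, norm_mul]
  simp only [h2]
  simpa [Function.comp_def] using (Real.continuous_sqrt.tendsto _).comp key

/-- The oscillating factor `e^{i t θ(ξ)}`. -/
def osc (θ : ℝ → ℝ) (t : ℝ) (ξ : ℝ) : ℂ := Complex.exp ((t * θ ξ : ℝ) * Complex.I)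

theorem norm_osc (θ : ℝ → ℝ) (t ξ : ℝ) : ‖osc θ t ξ‖ = 1 := Complex.norm_exp_ofReal_mul_I _

theorem osc_add (θ : ℝ → ℝ) (s t ξ : ℝ) : osc θ (s + t) ξ = osc θ s ξ * osc θ t ξ := by
  rw [osc, osc, osc, ← Complex.exp_add]; congr 1; push_cast; ring

theorem osc_zero (θ : ℝ → ℝ) (ξ : ℝ) : osc θ 0 ξ = 1 := by simp [osc]

theorem osc_neg_mul_osc (θ : ℝ → ℝ) (t ξ : ℝ) : osc θ (-t) ξ * osc θ t ξ = 1 := by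
  rw [← osc_add, neg_add_cancel, osc_zero]

theorem conj_osc (θ : ℝ → ℝ) (t ξ : ℝ) : conj (osc θ t ξ) = osc θ (-t) ξ := by
  rw [osc, osc, ← Complex.exp_conj]; simp

variable {θ : ℝ → ℝ}

theorem bddSymbol_osc (hθ : Measurable θ) (t : ℝ) : BddSymbol (osc θ t) :=
  ⟨by unfold osc; fun_prop, 1, fun ξ => (norm_osc θ t ξ).le⟩

theorem norm_mulOp_osc (hθ : Measurable θ) (t : ℝ) (g : L2) : ‖mulOp (osc θ t) g‖ = ‖g‖ := by
  have h : ∀ s (f : L2), ‖mulOp (osc θ s) f‖ ≤ ‖f‖ := fun s f => by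
    simpa using norm_mulOp_apply_le (bddSymbol_osc hθ s) (fun ξ => (norm_osc θ s ξ).le) f
  refine le_antisymm (h t g) ?_
  -- The reverse inequality is the contraction bound for the inverse operator.
  have h1 := h (-t) (mulOp (osc θ t) g)
  rw [mulOp_mulOp (bddSymbol_osc hθ _) (bddSymbol_osc hθ _)] at h1
  simp only [osc_neg_mul_osc, mulOp_one] at h1
  exact h1

theorem continuous_osc (ξ : ℝ) : Continuous fun t => osc θ t ξ := by unfold osc; fun_prop

/-- Joint strong continuity of the unitary group `e^{i t θ}`. -/
theorem continuous_mulOp_osc (hθ : Measurable θ) :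
    Continuous fun q : ℝ × L2 => mulOp (osc θ q.1) q.2 := by
  rw [continuous_iff_continuousAt]
  rintro ⟨t, g⟩
  -- For unbounded θ there is no norm continuity in t. The fixed vector `g` is handled by strong
  -- continuity, the remainder `q.2 - g` by the isometry property.
  have h1 : Tendsto (fun q : ℝ × L2 => mulOp (osc θ q.1) g) (𝓝 (t, g)) (𝓝 (mulOp (osc θ t) g)) :=
    tendsto_mulOp (fun q => bddSymbol_osc hθ _) (bddSymbol_osc hθ _)
      (fun q ξ => (norm_osc θ q.1 ξ).le)
      (fun ξ => ((continuous_osc ξ).comp continuous_fst).tendsto (t, g)) g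
  have h2 : Tendsto (fun q : ℝ × L2 => mulOp (osc θ q.1) (q.2 - g)) (𝓝 (t, g)) (𝓝 0) := by
    rw [tendsto_zero_iff_norm_tendsto_zero]
    simp only [norm_mulOp_osc hθ]
    have : Continuous fun q : ℝ × L2 => ‖q.2 - g‖ := by fun_prop
    simpa using this.tendsto (t, g)
  have h3 := h1.add h2
  simp only [add_zero] at h3
  refine h3.congr fun q => ?_
  rw [← map_add, add_sub_cancel]

/-- The Taylor bound covers |x| ≤ 1; beyond, the trivial bound 2 + |x| is at most 3x². No
restriction on x is allowed, since x will be hθ(ξ) with ξ arbitrary. -/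
theorem norm_exp_I_sub_one_sub_le (x : ℝ) :
    ‖Complex.exp (x * Complex.I) - 1 - x * Complex.I‖ ≤ 3 * x ^ 2 := by
  rcases le_total |x| 1 with h | h
  · have h1 := Complex.norm_exp_sub_one_sub_id_le (x := x * Complex.I) (by simpa using h)
    have h2 : ‖(x : ℂ) * Complex.I‖ = |x| := by simp
    rw [h2, sq_abs] at h1
    nlinarith [sq_nonneg x]
  · have h1 : ‖Complex.exp (x * Complex.I) - 1 - x * Complex.I‖ ≤ 1 + 1 + |x| := by
      refine (norm_sub_le _ _).trans (add_le_add ((norm_sub_le _ _).trans ?_) ?_)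
      · rw [Complex.norm_exp_ofReal_mul_I]; simp
      · simp
    nlinarith [sq_abs x]

/-- Differentiability in operator norm of the damped group `k e^{i t θ}`. -/
theorem hasDerivAt_mulOp_osc (hθ : Measurable θ) {k : ℝ → ℂ} (hk : BddSymbol k) {C : ℝ}
    (hC : ∀ ξ, ‖k ξ‖ * θ ξ ^ 2 ≤ C) (t : ℝ)
    (hd : BddSymbol fun ξ => Complex.I * θ ξ * (osc θ t ξ * k ξ)) :
    HasDerivAt (fun τ => mulOp (fun ξ => osc θ τ ξ * k ξ))
      (mulOp fun ξ => Complex.I * θ ξ * (osc θ t ξ * k ξ)) t := by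
  rw [hasDerivAt_iff_isLittleO_nhds_zero]
  -- The Taylor remainder at ξ is at most 3h²θ(ξ)², and `k` compensates θ², which makes the error
  -- O(h²) uniformly in ξ.
  have hb : ∀ h : ℝ, ‖mulOp (fun ξ => osc θ (t + h) ξ * k ξ) - mulOp (fun ξ => osc θ t ξ * k ξ)
      - h • mulOp (fun ξ => Complex.I * θ ξ * (osc θ t ξ * k ξ))‖ ≤ (3 * C) * ‖h ^ 2‖ := by
    intro h
    have hC0 : 0 ≤ C := le_trans (by positivity) (hC 0)
    refine ContinuousLinearMap.opNorm_le_bound _ (by positivity) fun g => ?_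
    apply Lp.norm_le_mul_norm_of_ae_le_mul
    have hA := (bddSymbol_osc hθ (t + h)).mul hk
    have hB := (bddSymbol_osc hθ t).mul hk
    rw [_root_.sub_apply, _root_.sub_apply,
      _root_.smul_apply]
    filter_upwards [coeFn_mulOp hA g, coeFn_mulOp hB g, coeFn_mulOp hd g,
      Lp.coeFn_sub (mulOp (fun ξ => osc θ (t + h) ξ * k ξ) g - mulOp (fun ξ => osc θ t ξ * k ξ) g)
        (h • mulOp (fun ξ => Complex.I * θ ξ * (osc θ t ξ * k ξ)) g),
      Lp.coeFn_sub (mulOp (fun ξ => osc θ (t + h) ξ * k ξ) g) (mulOp (fun ξ => osc θ t ξ * k ξ) g),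
      Lp.coeFn_smul h (mulOp (fun ξ => Complex.I * θ ξ * (osc θ t ξ * k ξ)) g)]
      with ξ h1 h2 h3 h4 h5 h6
    rw [h4, Pi.sub_apply, h5, Pi.sub_apply, h6, Pi.smul_apply, h1, h2, h3, Complex.real_smul]
    have e : osc θ (t + h) ξ * k ξ * g ξ - osc θ t ξ * k ξ * g ξ
        - h * (Complex.I * θ ξ * (osc θ t ξ * k ξ) * g ξ)
        = osc θ t ξ * (k ξ * (Complex.exp ((h * θ ξ : ℝ) * Complex.I) - 1
          - (h * θ ξ : ℝ) * Complex.I)) * g ξ := by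
      rw [osc_add]
      have : osc θ h ξ = Complex.exp ((h * θ ξ : ℝ) * Complex.I) := rfl
      rw [this]; push_cast; ring
    rw [e, norm_mul, norm_mul, norm_osc, one_mul, norm_mul]
    refine mul_le_mul_of_nonneg_right ?_ (norm_nonneg _)
    have h7 := norm_exp_I_sub_one_sub_le (h * θ ξ)
    calc ‖k ξ‖ * _ ≤ ‖k ξ‖ * (3 * (h * θ ξ) ^ 2) := by gcongr
      _ = 3 * (‖k ξ‖ * θ ξ ^ 2) * h ^ 2 := by ring
      _ ≤ 3 * C * h ^ 2 := by gcongr; exact hC ξ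
      _ = 3 * C * ‖h ^ 2‖ := by rw [Real.norm_of_nonneg (sq_nonneg h)]
  refine (Asymptotics.IsBigO.of_bound (3 * C) (Eventually.of_forall hb)).trans_isLittleO ?_
  simpa using Asymptotics.isLittleO_pow_id (𝕜 := ℝ) (one_lt_two)

end

section

/-! ### The inverse Fourier integral on `L¹ ∩ L²` -/

theorem continuous_fourierInv {f : ℝ → ℂ} (hf : Integrable f) : Continuous (𝓕⁻ f) := by
  have h : Continuous (𝓕 f) :=
    VectorFourier.fourierIntegral_continuous Real.continuous_fourierChar
      (by fun_prop) hf
  have h2 : 𝓕⁻ f = fun x => 𝓕 f (-x) := funext fun x => Real.fourierInv_eq_fourier_neg f x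
  rw [h2]
  exact h.comp continuous_neg

theorem integral_smul_fourierInv {f : ℝ → ℂ} (hf : Integrable f) (φ : 𝓢(ℝ, ℂ)) :
    ∫ x, φ x * 𝓕⁻ f x = ∫ ξ, 𝓕⁻ (φ : ℝ → ℂ) ξ * f ξ := by
  -- With the pairing `-(innerₗ ℝ)` the general Fourier integral is the inverse transform.
  have h := VectorFourier.integral_fourierIntegral_smul_eq_flip (μ := (volume : Measure ℝ))
    (ν := (volume : Measure ℝ)) (L := -(innerₗ ℝ)) (f := (φ : ℝ → ℂ)) (g := f)
    Real.continuous_fourierChar (by simp only [LinearMap.neg_apply]; fun_prop) φ.integrable hf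
  have h1 : (-(innerₗ ℝ : ℝ →ₗ[ℝ] ℝ →ₗ[ℝ] ℝ)).flip = -(innerₗ ℝ) := by
    ext; simp
  have h2 : ∀ f' : ℝ → ℂ, VectorFourier.fourierIntegral 𝐞 volume (-(innerₗ ℝ)) f' = 𝓕⁻ f' :=
    fun f' => rfl
  rw [h1, h2, h2] at h
  simpa only [smul_eq_mul] using h.symm

/-- Both functions have the same integral against every smooth compactly supported function: the
`L²` transform is compatible with that of tempered distributions, and the integral transform can be
moved onto the test function. -/
theorem fourierInv_toLp_ae {f : ℝ → ℂ} (h1 : Integrable f) (h2 : MemLp f 2 volume) :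
    ((𝓕⁻ (h2.toLp f) : L2) : ℝ → ℂ) =ᵐ[volume] 𝓕⁻ f := by
  refine ae_eq_of_integral_contDiff_smul_eq
    ((Lp.memLp _).locallyIntegrable (by norm_num)) (continuous_fourierInv h1).locallyIntegrable ?_
  intro g hg hgc
  have hg₁ : HasCompactSupport (Complex.ofRealCLM ∘ g) := hgc.comp_left rfl
  have hg₂ : ContDiff ℝ ((⊤ : ℕ∞) : WithTop ℕ∞) (Complex.ofRealCLM ∘ g) := by fun_prop
  set φ : 𝓢(ℝ, ℂ) := hg₁.toSchwartzMap hg₂ with hφ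
  have hφg : ∀ x, φ x = (g x : ℂ) := fun x => rfl
  have h3 := DFunLike.congr_fun (Lp.fourierInv_toTemperedDistribution_eq (h2.toLp f)) φ
  rw [TemperedDistribution.fourierInv_apply, Lp.toTemperedDistribution_apply,
    Lp.toTemperedDistribution_apply] at h3
  simp only [Complex.real_smul, ← hφg]
  simp only [smul_eq_mul] at h3
  rw [← h3, integral_smul_fourierInv h1 φ]
  apply integral_congr_ae
  filter_upwards [h2.coeFn_toLp] with x hx
  rw [hx, SchwartzMap.fourierInv_coe]

theorem memLp_fourierInv {f : ℝ → ℂ} (h1 : Integrable f) (h2 : MemLp f 2 volume) :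
    MemLp (𝓕⁻ f) 2 volume :=
  (memLp_congr_ae (fourierInv_toLp_ae h1 h2)).1 (Lp.memLp _)

theorem toLp_fourierInv {f : ℝ → ℂ} (h1 : Integrable f) (h2 : MemLp f 2 volume) :
    (memLp_fourierInv h1 h2).toLp (𝓕⁻ f) = (𝓕⁻ (h2.toLp f) : L2) :=
  Lp.ext ((memLp_fourierInv h1 h2).coeFn_toLp.trans (fourierInv_toLp_ae h1 h2).symm)

/-- Plancherel for functions of `L¹ ∩ L²`. -/
theorem integral_conj_fourierInv_mul {f h : ℝ → ℂ} (hf1 : Integrable f) (hf2 : MemLp f 2 volume)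
    (hh1 : Integrable h) (hh2 : MemLp h 2 volume) :
    ∫ x, conj (𝓕⁻ f x) * 𝓕⁻ h x = ∫ ξ, conj (f ξ) * h ξ := by
  have e : ⟪(𝓕⁻ (hf2.toLp f) : L2), 𝓕⁻ (hh2.toLp h)⟫_ℂ = ⟪hf2.toLp f, hh2.toLp h⟫_ℂ := by
    rw [← Lp.inner_fourier_eq, FourierTransform.fourier_fourierInv_eq,
      FourierTransform.fourier_fourierInv_eq]
  rw [L2.inner_def, L2.inner_def] at e
  convert e using 1
  · apply integral_congr_ae
    filter_upwards [fourierInv_toLp_ae hf1 hf2, fourierInv_toLp_ae hh1 hh2] with x h1 h2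
    rw [h1, h2, RCLike.inner_apply, mul_comm]
  · apply integral_congr_ae
    filter_upwards [hf2.coeFn_toLp, hh2.coeFn_toLp] with x h1 h2
    rw [h1, h2, RCLike.inner_apply, mul_comm]

theorem fourierInv_conj_neg (f : ℝ → ℂ) (x : ℝ) :
    𝓕⁻ (fun ξ => conj (f (-ξ))) x = conj (𝓕⁻ f x) := by
  rw [Real.fourierInv_eq', Real.fourierInv_eq', ← integral_conj,
    ← integral_neg_eq_self (fun v => Complex.exp _ • conj (f (-v)))]
  congr 1
  ext v
  simp only [smul_eq_mul, map_mul, ← Complex.exp_conj, neg_neg]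
  congr 2
  simp [Complex.conj_ofNat]

/-! ### The weight -/

/-- The weight `1 + (5/4) |2πξ|^α`. -/
def wt (α ξ : ℝ) : ℝ := 1 + 5 / 4 * |2 * Real.pi * ξ| ^ α

variable {α : ℝ}

theorem one_le_wt (α ξ : ℝ) : 1 ≤ wt α ξ := by
  have : 0 ≤ |2 * Real.pi * ξ| ^ α := by positivity
  unfold wt; linarith

theorem wt_pos (α ξ : ℝ) : 0 < wt α ξ := one_pos.trans_le (one_le_wt α ξ)

theorem wt_neg (α ξ : ℝ) : wt α (-ξ) = wt α ξ := by
  unfold wt; rw [mul_neg, abs_neg]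

theorem continuous_abs_rpow (hα : 1 < α) : Continuous fun ξ : ℝ => |2 * Real.pi * ξ| ^ α :=
  Continuous.rpow_const (by fun_prop) fun _ => Or.inr (by linarith)

theorem continuous_wt (hα : 1 < α) : Continuous (wt α) := by
  have := continuous_abs_rpow hα
  unfold wt; fun_prop

/-- From (x + y)^α ≤ (2 max x y)^α. In a convolution it shares the weight of the output frequency
between the two inputs. -/
theorem wt_le (hα : 1 < α) (ξ η : ℝ) : wt α ξ ≤ 2 ^ α * (wt α η + wt α (ξ - η)) := by
  set x := |2 * Real.pi * η|
  set y := |2 * Real.pi * (ξ - η)|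
  have hx : 0 ≤ x := abs_nonneg _
  have hy : 0 ≤ y := abs_nonneg _
  have h1 : |2 * Real.pi * ξ| ≤ x + y := by
    have : 2 * Real.pi * ξ = 2 * Real.pi * η + 2 * Real.pi * (ξ - η) := by ring
    rw [this]; exact abs_add_le _ _
  have h2 : |2 * Real.pi * ξ| ^ α ≤ (x + y) ^ α :=
    Real.rpow_le_rpow (abs_nonneg _) h1 (by linarith)
  have h3 : (x + y) ^ α ≤ 2 ^ α * (x ^ α + y ^ α) := by
    have hxy : x + y ≤ 2 * max x y := by
      linarith [le_max_left x y, le_max_right x y]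
    have hm : (max x y) ^ α ≤ x ^ α + y ^ α := by
      rcases max_cases x y with ⟨h, _⟩ | ⟨h, _⟩ <;> rw [h]
      · linarith [Real.rpow_nonneg hy α]
      · linarith [Real.rpow_nonneg hx α]
    calc (x + y) ^ α ≤ (2 * max x y) ^ α := Real.rpow_le_rpow (by positivity) hxy (by linarith)
      _ = 2 ^ α * (max x y) ^ α := Real.mul_rpow (by norm_num) (by positivity)
      _ ≤ _ := by gcongr
  have h4 : (1 : ℝ) ≤ 2 ^ α := Real.one_le_rpow (by norm_num) (by linarith)
  have : wt α η + wt α (ξ - η) = 2 + 5 / 4 * (x ^ α + y ^ α) := by unfold wt; ring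
  rw [this]
  unfold wt
  nlinarith

/-- Comparison with (1 + |ξ|)^{-α}; this is where α > 1 is decisive. -/
theorem integrable_inv_wt (hα : 1 < α) : Integrable fun ξ => (wt α ξ)⁻¹ := by
  have h1 : Integrable fun ξ : ℝ => 2 ^ α * (1 + ‖ξ‖) ^ (-α) :=
    (integrable_one_add_norm (by simpa using hα)).const_mul _
  refine h1.mono' ((continuous_wt hα).measurable.inv.aestronglyMeasurable)
    (ae_of_all _ fun ξ => ?_)
  rw [Real.norm_of_nonneg (inv_nonneg.2 (wt_pos α ξ).le), Real.rpow_neg (by positivity),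
    Real.norm_eq_abs, ← div_eq_mul_inv, inv_eq_one_div, div_le_div_iff₀ (wt_pos α ξ) (by positivity),
    one_mul]
  have h2 : |ξ| ≤ |2 * Real.pi * ξ| := by
    rw [abs_mul]
    refine le_mul_of_one_le_left (abs_nonneg _) ?_
    rw [abs_of_pos (by positivity)]; linarith [Real.pi_gt_three]
  have h3 : 1 + |ξ| ≤ 2 * max 1 |ξ| := by linarith [le_max_left 1 |ξ|, le_max_right 1 |ξ|]
  have h4 : (max 1 |ξ|) ^ α ≤ wt α ξ := by
    have h5 : |ξ| ^ α ≤ |2 * Real.pi * ξ| ^ α := Real.rpow_le_rpow (abs_nonneg _) h2 (by linarith)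
    have h6 : 0 ≤ |ξ| ^ α := by positivity
    unfold wt
    rcases max_cases 1 |ξ| with ⟨h, _⟩ | ⟨h, _⟩ <;> rw [h]
    · rw [Real.one_rpow]; linarith
    · linarith
  calc (1 + |ξ|) ^ α ≤ (2 * max 1 |ξ|) ^ α := Real.rpow_le_rpow (by positivity) h3 (by linarith)
    _ = 2 ^ α * (max 1 |ξ|) ^ α := Real.mul_rpow (by norm_num) (by positivity)
    _ ≤ _ := by gcongr

/-- One spatial derivative is controlled by the weight that multiplies u_t; this bounds the symbol
of the nonlinear term. -/
theorem abs_le_wt (hα : 1 < α) (ξ : ℝ) : |2 * Real.pi * ξ| ≤ wt α ξ := by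
  set x := |2 * Real.pi * ξ|
  have hx : 0 ≤ x := abs_nonneg _
  rcases le_total x 1 with h | h
  · exact h.trans (one_le_wt α ξ)
  · have h1 : x ≤ x ^ α := Real.self_le_rpow_of_one_le h hα.le
    have h2 : wt α ξ = 1 + 5 / 4 * x ^ α := rfl
    rw [h2]; linarith

/-- The square root of the weight. -/
def rwt (α ξ : ℝ) : ℝ := Real.sqrt (wt α ξ)

theorem rwt_pos (α ξ : ℝ) : 0 < rwt α ξ := Real.sqrt_pos.2 (wt_pos α ξ)

theorem one_le_rwt (α ξ : ℝ) : 1 ≤ rwt α ξ := Real.one_le_sqrt.2 (one_le_wt α ξ)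

theorem rwt_neg (α ξ : ℝ) : rwt α (-ξ) = rwt α ξ := by rw [rwt, wt_neg, rwt]

theorem rwt_mul_self (α ξ : ℝ) : rwt α ξ * rwt α ξ = wt α ξ := Real.mul_self_sqrt (wt_pos α ξ).le

theorem continuous_rwt (hα : 1 < α) : Continuous (rwt α) := (continuous_wt hα).sqrt

theorem rwt_ne_zero (α ξ : ℝ) : (rwt α ξ : ℂ) ≠ 0 := Complex.ofReal_ne_zero.2 (rwt_pos α ξ).ne'

/-- The symbol `(1 + (5/4) |2πξ|^α)^{-1/2}`. -/
def kap (α ξ : ℝ) : ℂ := ((rwt α ξ)⁻¹ : ℝ)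

theorem rwt_mul_kap (α ξ : ℝ) : (rwt α ξ : ℂ) * kap α ξ = 1 := by
  rw [kap, Complex.ofReal_inv, mul_inv_cancel₀ (rwt_ne_zero α ξ)]

theorem kap_ne_zero (α ξ : ℝ) : kap α ξ ≠ 0 := right_ne_zero_of_mul_eq_one (rwt_mul_kap α ξ)

theorem norm_kap (α ξ : ℝ) : ‖kap α ξ‖ = (rwt α ξ)⁻¹ := by
  rw [kap, Complex.norm_real, Real.norm_of_nonneg (inv_nonneg.2 (rwt_pos α ξ).le)]

theorem bddSymbol_kap (hα : 1 < α) : BddSymbol (kap α) :=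
  ⟨by
    have := (continuous_rwt hα).measurable
    unfold kap; fun_prop, 1, fun ξ => by
    rw [norm_kap]; exact inv_le_one_of_one_le₀ (one_le_rwt α ξ)⟩

theorem norm_kap_sq (α ξ : ℝ) : ‖kap α ξ‖ ^ 2 = (wt α ξ)⁻¹ := by
  rw [norm_kap, inv_pow, sq, rwt_mul_self]

theorem memLp_kap (hα : 1 < α) : MemLp (kap α) 2 volume := by
  rw [memLp_two_iff_integrable_sq_norm (bddSymbol_kap hα).measurable.aestronglyMeasurable]
  simpa only [norm_kap_sq] using integrable_inv_wt hα

/-- The Sobolev embedding: `kap α` lies in `L²`, so û = `kap α` · g is integrable and `U` is an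
honest integral, defined at every point. -/
theorem integrable_kap_mul (hα : 1 < α) (g : L2) : Integrable fun ξ => kap α ξ * g ξ :=
  (memLp_kap hα).integrable_mul (Lp.memLp g)

theorem memLp_kap_mul (hα : 1 < α) (g : L2) : MemLp (fun ξ => kap α ξ * g ξ) 2 volume :=
  (bddSymbol_kap hα).memLp g

/-- The function `u` with `û = (1 + (5/4) |2πξ|^α)^{-1/2} g`. -/
def U (α : ℝ) (g : L2) : ℝ → ℂ := 𝓕⁻ fun ξ => kap α ξ * g ξ

theorem memLp_U (hα : 1 < α) (g : L2) : MemLp (U α g) 2 volume :=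
  memLp_fourierInv (integrable_kap_mul hα g) (memLp_kap_mul hα g)

theorem toLp_U (hα : 1 < α) (g : L2) :
    (memLp_U hα g).toLp (U α g) = (𝓕⁻ (mulOp (kap α) g) : L2) := by
  rw [mulOp_apply (bddSymbol_kap hα)]
  exact toLp_fourierInv (integrable_kap_mul hα g) (memLp_kap_mul hα g)

theorem U_ae_injective (hα : 1 < α) {g h : L2} (H : U α g =ᵐ[volume] U α h) : g = h := by
  have h1 : (𝓕⁻ (mulOp (kap α) g) : L2) = 𝓕⁻ (mulOp (kap α) h) := by
    rw [← toLp_U hα, ← toLp_U hα]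
    exact MemLp.toLp_congr _ _ H
  have h2 := (Lp.fourierTransformₗᵢ ℝ ℂ).symm.injective h1
  exact mulOp_injective (bddSymbol_kap hα) (kap_ne_zero α) h2

/-- Identities between weighted transforms can thus be checked on the functions they represent,
where products are pointwise. -/
theorem U_injective (hα : 1 < α) : Function.Injective (U α) := fun _ _ h =>
  U_ae_injective hα (Filter.EventuallyEq.of_eq h)

theorem fourierInv_add_apply {f h : ℝ → ℂ} (hf : Integrable f) (hh : Integrable h) (x : ℝ) :
    𝓕⁻ (fun ξ => f ξ + h ξ) x = 𝓕⁻ f x + 𝓕⁻ h x := by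
  have e := VectorFourier.fourierIntegral_add (μ := (volume : Measure ℝ)) (L := -(innerₗ ℝ))
    Real.continuous_fourierChar (by simp only [LinearMap.neg_apply]; fun_prop) hf hh
  have h2 : ∀ f' : ℝ → ℂ, VectorFourier.fourierIntegral 𝐞 volume (-(innerₗ ℝ)) f' = 𝓕⁻ f' :=
    fun f' => rfl
  rw [h2, h2, h2] at e
  have e2 : (fun ξ => f ξ + h ξ) = f + h := rfl
  rw [e2, e, Pi.add_apply]

theorem U_add (hα : 1 < α) (g h : L2) (x : ℝ) : U α (g + h) x = U α g x + U α h x := by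
  unfold U
  rw [← fourierInv_add_apply (integrable_kap_mul hα g) (integrable_kap_mul hα h)]
  apply Real.fourierInv_congr_ae
  filter_upwards [Lp.coeFn_add g h] with ξ hξ
  rw [hξ, Pi.add_apply, mul_add]

theorem U_sub (hα : 1 < α) (g h : L2) (x : ℝ) : U α (g - h) x = U α g x - U α h x := by
  have := U_add hα (g - h) h x
  rw [sub_add_cancel] at this
  rw [this, add_sub_cancel_right]

end

section

variable {α : ℝ}

/-! ### The product -/

/-- The convolution of `κ g` and `κ h`. -/
def kconv (α : ℝ) (g h : L2) : ℝ → ℂ :=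
  convolution (fun ξ => kap α ξ * g ξ) (fun ξ => kap α ξ * h ξ) (ContinuousLinearMap.mul ℂ ℂ) volume

theorem kconv_apply (g h : L2) (ξ : ℝ) :
    kconv α g h ξ = ∫ η, kap α η * g η * (kap α (ξ - η) * h (ξ - η)) := rfl

theorem integrable_kconv (hα : 1 < α) (g h : L2) : Integrable (kconv α g h) :=
  (integrable_kap_mul hα g).integrable_convolution _ (integrable_kap_mul hα h)

/-- The constant of the product estimate. -/
def prodConst (α : ℝ) : ℝ≥0∞ :=
  ENNReal.ofReal (2 ^ α) * (2 * ∫⁻ ξ, ENNReal.ofReal (wt α ξ)⁻¹)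

theorem prodConst_ne_top (hα : 1 < α) : prodConst α ≠ ⊤ := by
  have h := (integrable_inv_wt hα).lintegral_lt_top
  exact ENNReal.mul_ne_top ENNReal.ofReal_ne_top (ENNReal.mul_ne_top (by norm_num) h.ne)

theorem enorm_kap_sq (α ξ : ℝ) : ‖kap α ξ‖ₑ ^ 2 = ENNReal.ofReal (wt α ξ)⁻¹ := by
  rw [← norm_kap_sq, ENNReal.ofReal_pow (norm_nonneg _), ofReal_norm]

theorem enorm_rwt_sq (α ξ : ℝ) : ‖(rwt α ξ : ℂ)‖ₑ ^ 2 = ENNReal.ofReal (wt α ξ) := by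
  rw [← ofReal_norm, ← ENNReal.ofReal_pow (norm_nonneg _), Complex.norm_real,
    Real.norm_of_nonneg (rwt_pos α ξ).le, sq, rwt_mul_self]

theorem measurable_wt (hα : 1 < α) : Measurable (wt α) := (continuous_wt hα).measurable

/-- By `wt_le`, wt(ξ)/(wt(η) wt(ξ-η)) ≤ 2^α (1/wt(η) + 1/wt(ξ-η)). By translation invariance both
terms have the same integral in η, whatever ξ is. -/
theorem lintegral_kernel_le (hα : 1 < α) (ξ : ℝ) :
    ‖(rwt α ξ : ℂ)‖ₑ ^ 2 * ∫⁻ η, (‖kap α η‖ₑ * ‖kap α (ξ - η)‖ₑ) ^ 2 ≤ prodConst α := by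
  have hm := measurable_wt hα
  have h1 : ∀ η, ‖(rwt α ξ : ℂ)‖ₑ ^ 2 * (‖kap α η‖ₑ * ‖kap α (ξ - η)‖ₑ) ^ 2
      ≤ ENNReal.ofReal (2 ^ α) *
        (ENNReal.ofReal (wt α η)⁻¹ + ENNReal.ofReal (wt α (ξ - η))⁻¹) := by
    intro η
    have p1 := wt_pos α η
    have p2 := wt_pos α (ξ - η)
    have p3 := wt_pos α ξ
    rw [mul_pow, enorm_kap_sq, enorm_kap_sq, enorm_rwt_sq,
      ← ENNReal.ofReal_mul (inv_nonneg.2 p1.le), ← ENNReal.ofReal_mul p3.le,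
      ← ENNReal.ofReal_add (inv_nonneg.2 p1.le) (inv_nonneg.2 p2.le),
      ← ENNReal.ofReal_mul (by positivity)]
    apply ENNReal.ofReal_le_ofReal
    have e : 2 ^ α * ((wt α η)⁻¹ + (wt α (ξ - η))⁻¹)
        = 2 ^ α * (wt α η + wt α (ξ - η)) * ((wt α η)⁻¹ * (wt α (ξ - η))⁻¹) := by
      field_simp; ring
    rw [e]
    exact mul_le_mul_of_nonneg_right (wt_le hα ξ η) (by positivity)
  rw [← lintegral_const_mul' _ _ (by rw [enorm_rwt_sq]; exact ENNReal.ofReal_ne_top)]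
  refine (lintegral_mono h1).trans ?_
  rw [lintegral_const_mul' _ _ ENNReal.ofReal_ne_top,
    lintegral_add_left (by fun_prop),
    lintegral_sub_left_eq_self (fun η => ENNReal.ofReal (wt α η)⁻¹) ξ, ← two_mul, prodConst]

/-- Cauchy–Schwarz in η, with the factors `kap` separated from `g` and `h`; the kernel bound is
uniform in ξ. -/
theorem enorm_kconv_sq_le (hα : 1 < α) (g h : L2) (ξ : ℝ) :
    ‖(rwt α ξ : ℂ) * kconv α g h ξ‖ₑ ^ 2 ≤ prodConst α * ∫⁻ η, (‖g η‖ₑ * ‖h (ξ - η)‖ₑ) ^ 2 := by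
  have hg := (Lp.stronglyMeasurable g).measurable
  have hh := (Lp.stronglyMeasurable h).measurable
  have hk := (bddSymbol_kap hα).measurable
  have h1 : ‖kconv α g h ξ‖ₑ ≤ ∫⁻ η, ((fun η => ‖g η‖ₑ * ‖h (ξ - η)‖ₑ) *
      (fun η => ‖kap α η‖ₑ * ‖kap α (ξ - η)‖ₑ)) η := by
    rw [kconv_apply]
    refine (enorm_integral_le_lintegral_enorm _).trans (le_of_eq ?_)
    congr 1; ext η
    simp only [enorm_mul, Pi.mul_apply]
    ring
  have h2 := ENNReal.lintegral_mul_le_Lp_mul_Lq volume Real.HolderConjugate.two_two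
    (f := fun η => ‖g η‖ₑ * ‖h (ξ - η)‖ₑ) (g := fun η => ‖kap α η‖ₑ * ‖kap α (ξ - η)‖ₑ)
    (by fun_prop) (by fun_prop)
  simp only [ENNReal.rpow_two] at h2
  have hsq : ∀ x : ℝ≥0∞, (x ^ (1 / 2 : ℝ)) ^ 2 = x := fun x => by
    rw [← ENNReal.rpow_two, ← ENNReal.rpow_mul]; norm_num
  rw [enorm_mul, mul_pow]
  calc ‖(rwt α ξ : ℂ)‖ₑ ^ 2 * ‖kconv α g h ξ‖ₑ ^ 2
      ≤ ‖(rwt α ξ : ℂ)‖ₑ ^ 2 * ((∫⁻ η, (‖g η‖ₑ * ‖h (ξ - η)‖ₑ) ^ 2)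
          * ∫⁻ η, (‖kap α η‖ₑ * ‖kap α (ξ - η)‖ₑ) ^ 2) := by
        gcongr
        refine (pow_le_pow_left' (h1.trans h2) 2).trans_eq ?_
        rw [mul_pow, hsq, hsq]
    _ = (‖(rwt α ξ : ℂ)‖ₑ ^ 2 * ∫⁻ η, (‖kap α η‖ₑ * ‖kap α (ξ - η)‖ₑ) ^ 2)
          * ∫⁻ η, (‖g η‖ₑ * ‖h (ξ - η)‖ₑ) ^ 2 := by ring
    _ ≤ _ := by gcongr; exact lintegral_kernel_le hα ξ

theorem lintegral_enorm_sq_eq (g : L2) : ∫⁻ ξ, ‖g ξ‖ₑ ^ 2 = ENNReal.ofReal ‖g‖ ^ 2 := by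
  rw [← ENNReal.ofReal_pow (norm_nonneg _), norm_sq_eq_integral,
    ofReal_integral_eq_lintegral_ofReal (integrable_norm_sq g) (ae_of_all _ fun _ => sq_nonneg _)]
  congr 1; ext ξ
  rw [ENNReal.ofReal_pow (norm_nonneg _), ofReal_norm]

theorem lintegral_enorm_kconv_sq_le (hα : 1 < α) (g h : L2) :
    ∫⁻ ξ, ‖(rwt α ξ : ℂ) * kconv α g h ξ‖ₑ ^ 2
      ≤ prodConst α * (ENNReal.ofReal ‖g‖ ^ 2 * ENNReal.ofReal ‖h‖ ^ 2) := by
  have hg := (Lp.stronglyMeasurable g).measurable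
  have hh := (Lp.stronglyMeasurable h).measurable
  refine (lintegral_mono (enorm_kconv_sq_le hα g h)).trans ?_
  -- Tonelli: integrating first in ξ, the translation of `h` disappears and the norms factor.
  rw [lintegral_const_mul' _ _ (prodConst_ne_top hα), lintegral_lintegral_swap (by fun_prop)]
  apply le_of_eq
  congr 1
  have h1 : ∀ η, ∫⁻ ξ, (‖g η‖ₑ * ‖h (ξ - η)‖ₑ) ^ 2 = ‖g η‖ₑ ^ 2 * ENNReal.ofReal ‖h‖ ^ 2 := by
    intro η
    simp only [mul_pow]
    rw [lintegral_const_mul' _ _ (by finiteness),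
      lintegral_sub_right_eq_self (fun ξ => ‖h ξ‖ₑ ^ 2) η, lintegral_enorm_sq_eq]
  simp only [h1]
  rw [lintegral_mul_const' _ _ (by finiteness), lintegral_enorm_sq_eq]

theorem eLpNorm_two_sq {f : ℝ → ℂ} : eLpNorm f 2 volume ^ 2 = ∫⁻ ξ, ‖f ξ‖ₑ ^ 2 := by
  have := eLpNorm_nnreal_pow_eq_lintegral (f := f) (μ := (volume : Measure ℝ))
    (p := 2) (by norm_num)
  simpa using this

theorem memLp_kconv (hα : 1 < α) (g h : L2) :
    MemLp (fun ξ => (rwt α ξ : ℂ) * kconv α g h ξ) 2 volume := by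
  have hr := (continuous_rwt hα).measurable
  refine ⟨(by fun_prop : Measurable fun ξ => (rwt α ξ : ℂ)).aestronglyMeasurable.mul
    (integrable_kconv hα g h).1, ?_⟩
  have h1 : eLpNorm (fun ξ => (rwt α ξ : ℂ) * kconv α g h ξ) 2 volume ^ 2 < ⊤ := by
    rw [eLpNorm_two_sq]
    refine (lintegral_enorm_kconv_sq_le hα g h).trans_lt ?_
    have := prodConst_ne_top hα
    finiteness
  by_contra hc
  rw [not_lt, top_le_iff] at hc
  rw [hc] at h1
  simp at h1

open Classical in
/-- The product of `H^{α/2}` in terms of the weighted Fourier transforms. -/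
def prod (α : ℝ) (g h : L2) : L2 :=
  if hα : 1 < α then (memLp_kconv hα g h).toLp _ else 0

theorem coeFn_prod (hα : 1 < α) (g h : L2) :
    prod α g h =ᵐ[volume] fun ξ => (rwt α ξ : ℂ) * kconv α g h ξ := by
  rw [prod, dif_pos hα]; exact MemLp.coeFn_toLp _

theorem exists_norm_prod_le (hα : 1 < α) : ∃ C : ℝ, 0 ≤ C ∧
    ∀ g h : L2, ‖prod α g h‖ ≤ C * ‖g‖ * ‖h‖ := by
  refine ⟨Real.sqrt (prodConst α).toReal, Real.sqrt_nonneg _, fun g h => ?_⟩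
  have h1 : ENNReal.ofReal ‖prod α g h‖ ^ 2
      ≤ prodConst α * (ENNReal.ofReal ‖g‖ ^ 2 * ENNReal.ofReal ‖h‖ ^ 2) := by
    rw [← lintegral_enorm_sq_eq]
    refine le_trans (le_of_eq (lintegral_congr_ae ?_)) (lintegral_enorm_kconv_sq_le hα g h)
    filter_upwards [coeFn_prod hα g h] with ξ hξ
    rw [hξ]
  rw [← ENNReal.ofReal_toReal (prodConst_ne_top hα), ← ENNReal.ofReal_pow (norm_nonneg _),
    ← ENNReal.ofReal_pow (norm_nonneg _), ← ENNReal.ofReal_pow (norm_nonneg _),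
    ← ENNReal.ofReal_mul (by positivity), ← ENNReal.ofReal_mul (by positivity),
    ENNReal.ofReal_le_ofReal_iff (by positivity)] at h1
  refine abs_le_of_sq_le_sq' ?_ (by positivity) |>.2
  rw [mul_pow, mul_pow, Real.sq_sqrt ENNReal.toReal_nonneg]
  linarith

/-- The convolution theorem, after the weight in `prod` cancels against `kap`. -/
theorem U_prod (hα : 1 < α) (g h : L2) (x : ℝ) : U α (prod α g h) x = U α g x * U α h x := by
  have h1 : U α (prod α g h) x = 𝓕⁻ (kconv α g h) x := by
    apply Real.fourierInv_congr_ae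
    filter_upwards [coeFn_prod hα g h] with ξ hξ
    rw [hξ, ← mul_assoc, mul_comm (kap α ξ), rwt_mul_kap, one_mul]
  rw [h1, U, U, Real.fourierInv_eq_fourier_neg, Real.fourierInv_eq_fourier_neg,
    Real.fourierInv_eq_fourier_neg]
  exact Real.fourier_mul_convolution_eq (integrable_kap_mul hα g) (integrable_kap_mul hα h) (-x)

theorem prod_sub_prod (hα : 1 < α) (g₁ h₁ g₂ h₂ : L2) :
    prod α g₁ h₁ - prod α g₂ h₂ = prod α (g₁ - g₂) h₁ + prod α g₂ (h₁ - h₂) := by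
  apply U_injective hα
  ext x
  rw [U_sub hα, U_add hα, U_prod hα, U_prod hα, U_prod hα, U_prod hα, U_sub hα, U_sub hα]
  ring

/-! ### Powers -/

/-- `npow α n g` represents the function `u^{n+1}` if `g` represents `u`. -/
def npow (α : ℝ) : ℕ → L2 → L2
  | 0, g => g
  | n + 1, g => prod α g (npow α n g)

theorem U_npow (hα : 1 < α) (n : ℕ) (g : L2) (x : ℝ) : U α (npow α n g) x = U α g x ^ (n + 1) := by
  induction n with
  | zero => simp [npow]
  | succ n ih => rw [npow, U_prod hα, ih, pow_succ' _ (n + 1)]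

theorem exists_npow_bound (hα : 1 < α) (n : ℕ) (R : ℝ) (hR : 0 ≤ R) :
    ∃ A : ℝ, 0 ≤ A ∧ ∀ g : L2, ‖g‖ ≤ R → ‖npow α n g‖ ≤ A := by
  obtain ⟨C, hC, hP⟩ := exists_norm_prod_le hα
  induction n with
  | zero => exact ⟨R, hR, fun g hg => hg⟩
  | succ n ih =>
    obtain ⟨A, hA, h⟩ := ih
    refine ⟨C * R * A, by positivity, fun g hg => (hP _ _).trans ?_⟩
    have := h g hg
    gcongr

theorem exists_npow_lipschitz (hα : 1 < α) (n : ℕ) (R : ℝ) (hR : 0 ≤ R) :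
    ∃ K : ℝ, 0 ≤ K ∧ ∀ g h : L2, ‖g‖ ≤ R → ‖h‖ ≤ R →
      ‖npow α n g - npow α n h‖ ≤ K * ‖g - h‖ := by
  obtain ⟨C, hC, hP⟩ := exists_norm_prod_le hα
  induction n with
  | zero => exact ⟨1, one_pos.le, fun g h _ _ => by simp [npow]⟩
  | succ n ih =>
    obtain ⟨K, hK, ihK⟩ := ih
    obtain ⟨A, hA, hb⟩ := exists_npow_bound hα n R hR
    refine ⟨C * A + C * R * K, by positivity, fun g h hg hh => ?_⟩
    rw [npow, npow, prod_sub_prod hα]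
    have h1 := hb g hg
    have h2 := ihK g h hg hh
    calc _ ≤ C * ‖g - h‖ * ‖npow α n g‖ + C * ‖h‖ * ‖npow α n g - npow α n h‖ :=
          (norm_add_le _ _).trans (add_le_add (hP _ _) (hP _ _))
      _ ≤ C * ‖g - h‖ * A + C * R * (K * ‖g - h‖) := by gcongr
      _ = _ := by ring

theorem continuous_npow (hα : 1 < α) (n : ℕ) : Continuous (npow α n) := by
  rw [continuous_iff_continuousAt]
  intro g
  obtain ⟨K, hK, h⟩ := exists_npow_lipschitz hα n (‖g‖ + 1) (by positivity)
  have hL : LipschitzOnWith K.toNNReal (npow α n) (Metric.closedBall 0 (‖g‖ + 1)) := by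
    refine LipschitzOnWith.of_dist_le_mul fun x hx y hy => ?_
    rw [dist_eq_norm, dist_eq_norm, Real.coe_toNNReal K hK]
    exact h x y (by simpa using hx) (by simpa using hy)
  refine hL.continuousOn.continuousAt ?_
  refine mem_of_superset (Metric.ball_mem_nhds g one_pos) fun x hx => ?_
  rw [mem_closedBall_zero_iff]
  have := norm_le_norm_add_norm_sub' x g
  rw [mem_ball_iff_norm] at hx
  linarith

/-! ### Real-valued functions -/

theorem quasi_neg : Measure.QuasiMeasurePreserving (fun ξ : ℝ => -ξ) volume volume :=
  (Measure.measurePreserving_neg volume).quasiMeasurePreserving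

theorem memLp_conj_neg (g : L2) : MemLp (fun ξ => conj (g (-ξ))) 2 volume := by
  have h1 : MemLp (fun ξ => g (-ξ)) 2 volume :=
    (Lp.memLp g).comp_measurePreserving (Measure.measurePreserving_neg volume)
  exact (memLp_congr_norm (Complex.continuous_conj.comp_aestronglyMeasurable h1.1) h1.1
    (ae_of_all _ fun ξ => by simp)).2 h1

/-- The conjugation `g ↦ conj (g (-ξ))`, which corresponds to `u ↦ conj u`. -/
def refl (g : L2) : L2 := (memLp_conj_neg g).toLp _

theorem coeFn_refl (g : L2) : refl g =ᵐ[volume] fun ξ => conj (g (-ξ)) := MemLp.coeFn_toLp _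

theorem kap_neg (α ξ : ℝ) : kap α (-ξ) = kap α ξ := by rw [kap, rwt_neg, kap]

theorem conj_kap (α ξ : ℝ) : conj (kap α ξ) = kap α ξ := Complex.conj_ofReal _

theorem U_refl (g : L2) (x : ℝ) : U α (refl g) x = conj (U α g x) := by
  rw [U, U, ← fourierInv_conj_neg]
  apply Real.fourierInv_congr_ae
  filter_upwards [coeFn_refl g] with ξ hξ
  rw [hξ, map_mul, kap_neg, conj_kap]

theorem refl_npow (hα : 1 < α) (n : ℕ) (g : L2) : refl (npow α n g) = npow α n (refl g) := by
  apply U_injective hα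
  ext x
  rw [U_refl, U_npow hα, U_npow hα, U_refl, map_pow]

theorem refl_mulOp {a : ℝ → ℂ} (ha : BddSymbol a) (h : ∀ ξ, conj (a (-ξ)) = a ξ) (g : L2) :
    refl (mulOp a g) = mulOp a (refl g) := by
  apply Lp.ext
  filter_upwards [coeFn_refl (mulOp a g), coeFn_refl g, coeFn_mulOp ha (refl g),
    quasi_neg.ae (coeFn_mulOp ha g)] with ξ h1 h2 h3 h4
  rw [h1, h4, h3, h2, map_mul, h]

theorem refl_add (g h : L2) : refl (g + h) = refl g + refl h := by
  apply Lp.ext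
  filter_upwards [coeFn_refl (g + h), coeFn_refl g, coeFn_refl h, Lp.coeFn_add (refl g) (refl h),
    quasi_neg.ae (Lp.coeFn_add g h)] with ξ h1 h2 h3 h4 h5
  rw [h1, h5, h4, Pi.add_apply, Pi.add_apply, h2, h3, map_add]

theorem refl_smul (c : ℝ) (g : L2) : refl (c • g) = c • refl g := by
  apply Lp.ext
  filter_upwards [coeFn_refl (c • g), coeFn_refl g, Lp.coeFn_smul c (refl g),
    quasi_neg.ae (Lp.coeFn_smul c g)] with ξ h1 h2 h3 h4
  rw [h1, h4, h3, Pi.smul_apply, Pi.smul_apply, h2, Complex.real_smul, Complex.real_smul, map_mul,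
    Complex.conj_ofReal]

theorem norm_refl (g : L2) : ‖refl g‖ = ‖g‖ := by
  rw [refl, Lp.norm_toLp, Lp.norm_def]
  congr 1
  rw [← eLpNorm_comp_measurePreserving (Lp.aestronglyMeasurable g)
    (Measure.measurePreserving_neg volume)]
  exact eLpNorm_congr_norm_ae (ae_of_all _ fun ξ => by simp)

/-- The closed real subspace of `L²` that corresponds to the real-valued functions. -/
def realSubmodule : Submodule ℝ L2 where
  carrier := {g | refl g = g}
  zero_mem' := by
    have := refl_smul 0 0
    simpa using this
  add_mem' {g h} hg hh := by
    simp only [mem_ofPred_eq] at *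
    rw [refl_add, hg, hh]
  smul_mem' c g hg := by
    simp only [mem_ofPred_eq] at *
    rw [refl_smul, hg]

theorem mem_realSubmodule {g : L2} : g ∈ realSubmodule ↔ refl g = g := Iff.rfl

theorem continuous_refl : Continuous refl := by
  refine LipschitzWith.continuous (K := 1) (LipschitzWith.of_dist_le_mul fun g h => ?_)
  have h1 : refl g - refl h = refl (g - h) := by
    have h2 := refl_add (g - h) h
    rw [sub_add_cancel] at h2
    rw [h2, add_sub_cancel_right]
  rw [dist_eq_norm, dist_eq_norm, h1, norm_refl]
  simp

theorem isClosed_realSubmodule : IsClosed (realSubmodule : Set L2) :=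
  isClosed_eq continuous_refl continuous_id

theorem conj_U {g : L2} (hg : g ∈ realSubmodule) (x : ℝ) : conj (U α g x) = U α g x := by
  rw [← U_refl, mem_realSubmodule.1 hg]

end

section

/-! ### Global solutions of norm-preserving differential equations -/

section ODE

variable {E : Type*} [NormedAddCommGroup E]

/-- The factor of the radial retraction onto the ball of radius `R`. -/
def radialFactor (R : ℝ) (x : E) : ℝ := R / max R ‖x‖

theorem radialFactor_pos {R : ℝ} (hR : 0 < R) (x : E) : 0 < radialFactor R x :=
  div_pos hR (lt_max_of_lt_left hR)

theorem radialFactor_eq_one {R : ℝ} (hR : 0 < R) {x : E} (hx : ‖x‖ ≤ R) : radialFactor R x = 1 := by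
  rw [radialFactor, max_eq_left hx, div_self hR.ne']

variable [InnerProductSpace ℝ E]

theorem norm_radialFactor_smul_le {R : ℝ} (hR : 0 < R) (x : E) : ‖radialFactor R x • x‖ ≤ R := by
  have hm : 0 < max R ‖x‖ := lt_max_of_lt_left hR
  rw [norm_smul, Real.norm_of_nonneg (radialFactor_pos hR x).le, radialFactor, div_mul_eq_mul_div,
    div_le_iff₀ hm]
  exact mul_le_mul_of_nonneg_left (le_max_right _ _) hR.le

/-- The difference splits into x - y scaled by a factor at most 1, and the change of the factor
applied to y. Each part contributes at most ‖x - y‖. -/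
theorem norm_radialFactor_smul_sub_le {R : ℝ} (hR : 0 < R) (x y : E) :
    ‖radialFactor R x • x - radialFactor R y • y‖ ≤ 2 * ‖x - y‖ := by
  have hx : 0 < max R ‖x‖ := lt_max_of_lt_left hR
  have hy : 0 < max R ‖y‖ := lt_max_of_lt_left hR
  have e : radialFactor R x • x - radialFactor R y • y
      = radialFactor R x • (x - y) + (radialFactor R x - radialFactor R y) • y := by
    rw [smul_sub, sub_smul]; abel
  have h1 : radialFactor R x ≤ 1 := (div_le_one hx).2 (le_max_left _ _)
  have h2 : |radialFactor R x - radialFactor R y| * ‖y‖ ≤ ‖x - y‖ := by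
    have e2 : radialFactor R x - radialFactor R y
        = R / max R ‖x‖ * ((max R ‖y‖ - max R ‖x‖) / max R ‖y‖) := by
      unfold radialFactor; field_simp
    have h3 : |max R ‖y‖ - max R ‖x‖| ≤ ‖x - y‖ := by
      refine (abs_max_sub_max_le_max R ‖y‖ R ‖x‖).trans ?_
      rw [sub_self, abs_zero, max_eq_right (abs_nonneg _), abs_sub_comm]
      exact abs_norm_sub_norm_le x y
    rw [e2, abs_mul, abs_div (max R ‖y‖ - _), abs_of_pos hy, abs_of_pos (div_pos hR hx)]
    have h4 : |max R ‖y‖ - max R ‖x‖| * ‖y‖ / max R ‖y‖ ≤ |max R ‖y‖ - max R ‖x‖| := by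
      rw [div_le_iff₀ hy]
      exact mul_le_mul_of_nonneg_left (le_max_right _ _) (abs_nonneg _)
    calc _ = radialFactor R x * (|max R ‖y‖ - max R ‖x‖| * ‖y‖ / max R ‖y‖) := by
          unfold radialFactor; ring
      _ ≤ 1 * |max R ‖y‖ - max R ‖x‖| := mul_le_mul h1 h4 (by positivity) one_pos.le
      _ ≤ _ := by rwa [one_mul]
  rw [e]
  refine (norm_add_le _ _).trans ?_
  rw [norm_smul, norm_smul, Real.norm_of_nonneg (radialFactor_pos hR x).le, Real.norm_eq_abs]
  nlinarith [norm_nonneg (x - y)]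

theorem hasDerivWithinAt_Ici_of_Icc {α : ℝ → E} {α' : E} {T t : ℝ} (ht : t ∈ Ico 0 T)
    (h : HasDerivWithinAt α α' (Icc 0 T) t) : HasDerivWithinAt α α' (Ici t) t :=
  h.mono_of_mem_nhdsWithin (Icc_mem_nhdsGE_of_mem ht)

variable [CompleteSpace E] {f : ℝ → E → E}

/-- Composition with the radial retraction makes the field globally bounded and Lipschitz, so
Picard–Lindelöf reaches any T at once. Orthogonality then keeps the norm constant, and the
retraction never acts on the solution. -/
theorem exists_solution_Icc (hcont : ∀ x, Continuous fun t => f t x)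
    (hlip : ∀ R, 0 ≤ R → ∃ K, 0 ≤ K ∧ ∀ t x y, ‖x‖ ≤ R → ‖y‖ ≤ R →
      ‖f t x - f t y‖ ≤ K * ‖x - y‖)
    (hbd : ∀ R, 0 ≤ R → ∃ A, 0 ≤ A ∧ ∀ t x, ‖x‖ ≤ R → ‖f t x‖ ≤ A)
    (horth : ∀ t x, ⟪x, f t x⟫_ℝ = 0) (x₀ : E) {T : ℝ} (hT : 0 ≤ T) :
    ∃ α : ℝ → E, α 0 = x₀ ∧ (∀ t ∈ Icc 0 T, HasDerivWithinAt α (f t (α t)) (Icc 0 T) t) ∧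
      ∀ t ∈ Icc 0 T, ‖α t‖ = ‖x₀‖ := by
  set R := ‖x₀‖ + 1
  have hR : 0 < R := by positivity
  obtain ⟨K, hK, hKl⟩ := hlip R hR.le
  obtain ⟨A, hA, hAb⟩ := hbd R hR.le
  lift A to ℝ≥0 using hA
  lift K to ℝ≥0 using hK
  lift T to ℝ≥0 using hT
  -- The radius A·T is as far as a curve of speed at most A can move in time T; 2K combines the
  -- Lipschitz constants of the field and of the retraction.
  have hPL : IsPicardLindelof (fun t x => f t (radialFactor R x • x))
      (⟨0, left_mem_Icc.2 T.2⟩ : Icc (0 : ℝ) T) x₀ (A * T) 0 A (2 * K) := by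
    refine ⟨fun t _ => LipschitzOnWith.of_dist_le_mul fun x _ y _ => ?_,
      fun x _ => (hcont _).continuousOn,
      fun t _ x _ => hAb t _ (norm_radialFactor_smul_le hR x), ?_⟩
    · rw [dist_eq_norm, dist_eq_norm]
      refine (hKl t _ _ (norm_radialFactor_smul_le hR x) (norm_radialFactor_smul_le hR y)).trans ?_
      have := norm_radialFactor_smul_sub_le hR x y
      calc (K : ℝ) * _ ≤ K * (2 * ‖x - y‖) := by gcongr
        _ = _ := by push_cast; ring
    · simp
  obtain ⟨α, h0, hd⟩ := hPL.exists_eq_forall_mem_Icc_hasDerivWithinAt₀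
  replace h0 : α 0 = x₀ := h0
  have hcα : ContinuousOn α (Icc 0 T) := fun t ht => (hd t ht).continuousWithinAt
  have hnorm : ∀ t ∈ Icc (0 : ℝ) T, ‖α t‖ ^ 2 = ‖α 0‖ ^ 2 := by
    refine constant_of_has_deriv_right_zero (hcα.norm.pow 2) fun t ht => ?_
    have h1 := hasDerivWithinAt_Ici_of_Icc ht (hd t (Ico_subset_Icc_self ht))
    have h2 := h1.norm_sq
    -- The retraction only rescales the vector by a positive factor, so orthogonality survives
    -- truncation.
    have h3 : ⟪α t, f t (radialFactor R (α t) • α t)⟫_ℝ = 0 := by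
      have h4 := horth t (radialFactor R (α t) • α t)
      rw [real_inner_smul_left] at h4
      exact (mul_eq_zero.1 h4).resolve_left (radialFactor_pos hR _).ne'
    rw [h3, mul_zero] at h2
    exact h2
  have hnorm' : ∀ t ∈ Icc (0 : ℝ) T, ‖α t‖ = ‖x₀‖ := fun t ht => by
    rw [← h0]
    exact (sq_eq_sq₀ (norm_nonneg _) (norm_nonneg _)).1 (hnorm t ht)
  refine ⟨α, h0, fun t ht => ?_, hnorm'⟩
  have h1 := hd t ht
  rwa [radialFactor_eq_one hR (by rw [hnorm' t ht]; simp [R]), one_smul] at h1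

theorem exists_global_solution (hcont : ∀ x, Continuous fun t => f t x)
    (hlip : ∀ R, 0 ≤ R → ∃ K, 0 ≤ K ∧ ∀ t x y, ‖x‖ ≤ R → ‖y‖ ≤ R →
      ‖f t x - f t y‖ ≤ K * ‖x - y‖)
    (hbd : ∀ R, 0 ≤ R → ∃ A, 0 ≤ A ∧ ∀ t x, ‖x‖ ≤ R → ‖f t x‖ ≤ A)
    (horth : ∀ t x, ⟪x, f t x⟫_ℝ = 0) (x₀ : E) :
    ∃ w : ℝ → E, w 0 = x₀ ∧ ∀ t ∈ Ici (0 : ℝ), HasDerivWithinAt w (f t (w t)) (Ici 0) t := by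
  choose α h0 hd hn using fun n : ℕ =>
    exists_solution_Icc hcont hlip hbd horth x₀ (Nat.cast_nonneg (α := ℝ) n)
  have huniq : ∀ m n : ℕ, m ≤ n → EqOn (α m) (α n) (Icc 0 m) := by
    intro m n hmn
    obtain ⟨K, hK, hKl⟩ := hlip ‖x₀‖ (norm_nonneg _)
    have hmn' : (m : ℝ) ≤ n := Nat.cast_le.2 hmn
    have hsub : Icc (0 : ℝ) m ⊆ Icc 0 n := Icc_subset_Icc_right hmn'
    refine ODE_solution_unique_of_mem_Icc_right (v := f) (K := K.toNNReal)
      (s := fun _ => Metric.closedBall 0 ‖x₀‖) ?_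
      (fun t ht => (hd m t ht).continuousWithinAt)
      (fun t ht => hasDerivWithinAt_Ici_of_Icc ht (hd m t (Ico_subset_Icc_self ht)))
      (fun t ht => by simp [hn m t (Ico_subset_Icc_self ht)])
      (fun t ht => ((hd n t (hsub ht)).continuousWithinAt).mono hsub)
      (fun t ht => hasDerivWithinAt_Ici_of_Icc ⟨ht.1, ht.2.trans_le hmn'⟩
        (hd n t (hsub (Ico_subset_Icc_self ht))))
      (fun t ht => by simp [hn n t (hsub (Ico_subset_Icc_self ht))]) (by rw [h0, h0])
    intro t _
    refine LipschitzOnWith.of_dist_le_mul fun x hx y hy => ?_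
    rw [dist_eq_norm, dist_eq_norm, Real.coe_toNNReal K hK]
    exact hKl t x y (by simpa using hx) (by simpa using hy)
  -- The glued curve uses at time s the solution on [0, ⌊s⌋ + 1]; by uniqueness it agrees with each
  -- longer one, hence is differentiable across integer times.
  have hw : ∀ n : ℕ, ∀ s ∈ Ico (0 : ℝ) n, α (⌊s⌋₊ + 1) s = α n s := by
    intro n s hs
    refine huniq _ _ ?_ ⟨hs.1, ?_⟩
    · exact Nat.succ_le_of_lt ((Nat.floor_lt hs.1).2 hs.2)
    · push_cast; exact (Nat.lt_floor_add_one s).le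
  refine ⟨fun t => α (⌊t⌋₊ + 1) t, h0 _, fun t ht => ?_⟩
  set n := ⌊t⌋₊ + 1
  have htn : t ∈ Ico (0 : ℝ) n := ⟨ht, by simp only [n]; push_cast; exact Nat.lt_floor_add_one t⟩
  have hmem : Ico (0 : ℝ) n ∈ 𝓝[Ici 0] t := by
    rw [← Ici_inter_Iio]
    exact inter_mem_nhdsWithin _ (Iio_mem_nhds htn.2)
  have h1 : HasDerivWithinAt (α n) (f t (α n t)) (Ici 0) t :=
    (hd n t (Ico_subset_Icc_self htn)).mono_of_mem_nhdsWithin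
      (mem_of_superset hmem Ico_subset_Icc_self)
  refine h1.congr_of_eventuallyEq ?_ rfl
  filter_upwards [hmem] with s hs using hw n s hs

end ODE

end

section

variable {α : ℝ}

/-! ### The symbols of the equation and conservation of energy -/

/-- The dispersion relation `2πξ (1 + (3/4) |2πξ|^α) / (1 + (5/4) |2πξ|^α)`. -/
def disp (α ξ : ℝ) : ℝ := 2 * Real.pi * ξ * (1 + 3 / 4 * |2 * Real.pi * ξ| ^ α) / wt α ξ

theorem disp_neg (α ξ : ℝ) : disp α (-ξ) = -disp α ξ := by
  unfold disp; rw [wt_neg, mul_neg, abs_neg]; ring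

theorem continuous_disp (hα : 1 < α) : Continuous (disp α) := by
  have h1 := continuous_abs_rpow hα
  have h2 := continuous_wt hα
  unfold disp
  exact Continuous.div (by fun_prop) h2 fun ξ => (wt_pos α ξ).ne'

theorem measurable_disp (hα : 1 < α) : Measurable (disp α) := (continuous_disp hα).measurable

/-- The symbol `-iπξ / (1 + (5/4) |2πξ|^α)` of the nonlinear term. -/
def nl (α ξ : ℝ) : ℂ := (-(Real.pi * ξ) / wt α ξ : ℝ) * Complex.I

theorem norm_nl_le (hα : 1 < α) (ξ : ℝ) : ‖nl α ξ‖ ≤ 1 := by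
  rw [nl, norm_mul, Complex.norm_I, mul_one, Complex.norm_real, norm_div,
    Real.norm_of_nonneg (wt_pos α ξ).le, div_le_one (wt_pos α ξ), norm_neg, Real.norm_eq_abs]
  refine le_trans ?_ (abs_le_wt hα ξ)
  rw [mul_assoc, abs_mul 2, abs_two]
  have := abs_nonneg (Real.pi * ξ)
  linarith

theorem bddSymbol_nl (hα : 1 < α) : BddSymbol (nl α) :=
  ⟨by
    have := measurable_wt hα
    unfold nl; fun_prop, 1, norm_nl_le hα⟩

theorem conj_nl (α ξ : ℝ) : conj (nl α ξ) = -nl α ξ := by simp [nl]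

theorem nl_neg (α ξ : ℝ) : nl α (-ξ) = -nl α ξ := by
  unfold nl; rw [wt_neg]; push_cast; ring

/-- The dispersion relation is odd, so the group preserves real-valued functions. -/
theorem conj_osc_neg (t ξ : ℝ) : conj (osc (disp α) t (-ξ)) = osc (disp α) t ξ := by
  rw [conj_osc, osc, osc, disp_neg]; simp

/-- The frequency cutoff. -/
def cut (n : ℕ) (ξ : ℝ) : ℂ := indicator (Icc (-(n : ℝ)) n) 1 ξ

theorem cut_eq (n : ℕ) (ξ : ℝ) : cut n ξ = if |ξ| ≤ n then 1 else 0 := by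
  simp [cut, indicator_apply, abs_le]

theorem norm_cut_le (n : ℕ) (ξ : ℝ) : ‖cut n ξ‖ ≤ 1 := by
  rw [cut_eq]; split_ifs <;> simp

theorem measurable_cut (n : ℕ) : Measurable (cut n) :=
  measurable_one.indicator measurableSet_Icc

theorem bddSymbol_cut (n : ℕ) : BddSymbol (cut n) := ⟨measurable_cut n, 1, norm_cut_le n⟩

theorem conj_cut_neg (n : ℕ) (ξ : ℝ) : conj (cut n (-ξ)) = cut n ξ := by
  rw [cut_eq, cut_eq, abs_neg]; split_ifs <;> simp

theorem tendsto_cut (g : L2) : Tendsto (fun n => mulOp (cut n) g) atTop (𝓝 g) := by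
  have h := tendsto_mulOp (a := fun _ => 1) (s := cut) (l := atTop) bddSymbol_cut
    ⟨measurable_const, 1, fun _ => by simp⟩ norm_cut_le (fun ξ => ?_) g
  · rwa [mulOp_one] at h
  · refine tendsto_const_nhds.congr' ?_
    obtain ⟨N, hN⟩ := exists_nat_ge |ξ|
    filter_upwards [eventually_ge_atTop N] with n hn
    rw [cut_eq, if_pos (hN.trans (Nat.cast_le.2 hn))]

/-- The symbol of the derivative of a function of bounded frequencies. -/
def dcut (n : ℕ) (ξ : ℝ) : ℂ := 2 * Real.pi * Complex.I * ξ * cut n ξ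

theorem bddSymbol_dcut (n : ℕ) : BddSymbol (dcut n) := by
  refine ⟨by have := measurable_cut n; unfold dcut; fun_prop, 2 * Real.pi * n, fun ξ => ?_⟩
  rw [dcut, cut_eq]
  split_ifs with h
  · simp only [norm_mul, Complex.norm_I, Complex.norm_real, mul_one, Complex.norm_ofNat,
      Real.norm_eq_abs, abs_of_pos Real.pi_pos]
    have := Real.pi_pos
    gcongr
  · simpa using (by positivity : 0 ≤ 2 * Real.pi * n)

theorem conj_dcut_neg (n : ℕ) (ξ : ℝ) : conj (dcut n (-ξ)) = dcut n ξ := by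
  rw [dcut, dcut, map_mul, conj_cut_neg]
  simp [Complex.conj_ofNat]

theorem mulOp_mem_realSubmodule {a : ℝ → ℂ} (ha : BddSymbol a) (h : ∀ ξ, conj (a (-ξ)) = a ξ)
    {g : L2} (hg : g ∈ realSubmodule) : mulOp a g ∈ realSubmodule := by
  rw [mem_realSubmodule, refl_mulOp ha h, mem_realSubmodule.1 hg]

theorem npow_mem_realSubmodule (hα : 1 < α) (n : ℕ) {g : L2} (hg : g ∈ realSubmodule) :
    npow α n g ∈ realSubmodule := by
  rw [mem_realSubmodule, refl_npow hα, mem_realSubmodule.1 hg]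

theorem hasDerivAt_fourierInv {f : ℝ → ℂ} (hf : Integrable f) (hf' : Integrable fun ξ => ξ • f ξ)
    (x : ℝ) : HasDerivAt (𝓕⁻ f) (𝓕⁻ (fun ξ => 2 * Real.pi * Complex.I * ξ * f ξ) x) x := by
  have h1 : Integrable fun ξ => f (-ξ) := hf.comp_neg
  have h2 : Integrable fun ξ => ξ • f (-ξ) := by
    simpa using hf'.comp_neg.neg
  have h := Real.hasDerivAt_fourier h1 h2 x
  rw [Real.fourierInv_eq_fourier_comp_neg, Real.fourierInv_eq_fourier_comp_neg]
  have e : (fun ξ => 2 * Real.pi * Complex.I * ((-ξ : ℝ) : ℂ) * f (-ξ))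
      = fun ξ : ℝ => (-2 * Real.pi * Complex.I * ξ) • f (-ξ) := by
    ext ξ
    rw [smul_eq_mul]; push_cast; ring
  rw [← e] at h
  exact h

theorem hasDerivAt_U_cut (hα : 1 < α) (n : ℕ) (g : L2) (x : ℝ) :
    HasDerivAt (U α (mulOp (cut n) g)) (U α (mulOp (dcut n) g) x) x := by
  have e : (fun ξ => kap α ξ * mulOp (dcut n) g ξ) =ᵐ[volume]
      fun ξ => 2 * Real.pi * Complex.I * ξ * (kap α ξ * mulOp (cut n) g ξ) := by
    filter_upwards [coeFn_mulOp (bddSymbol_dcut n) g, coeFn_mulOp (bddSymbol_cut n) g] with ξ h1 h2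
    rw [h1, h2, dcut]; ring
  have hi : Integrable fun ξ : ℝ => ξ • (kap α ξ * mulOp (cut n) g ξ) := by
    have h1 := ((integrable_kap_mul hα (mulOp (dcut n) g)).congr e).const_mul
      (2 * Real.pi * Complex.I)⁻¹
    refine h1.congr (ae_of_all _ fun ξ => ?_)
    have h2 : (2 * Real.pi * Complex.I : ℂ) ≠ 0 := Complex.two_pi_I_ne_zero
    simp only [Complex.real_smul]
    field_simp
  have h := hasDerivAt_fourierInv (integrable_kap_mul hα (mulOp (cut n) g)) hi x
  have h2 : U α (mulOp (dcut n) g) x = _ := Real.fourierInv_congr_ae e x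
  rw [h2]
  exact h

theorem integral_conj_U_mul_U (hα : 1 < α) (g h : L2) :
    ∫ x, conj (U α g x) * U α h x = ∫ ξ, conj (kap α ξ * g ξ) * (kap α ξ * h ξ) :=
  integral_conj_fourierInv_mul (integrable_kap_mul hα g) (memLp_kap_mul hα g)
    (integrable_kap_mul hα h) (memLp_kap_mul hα h)

theorem integrable_U_mul_U (hα : 1 < α) (g h : L2) : Integrable fun x => U α g x * U α h x :=
  (memLp_U hα g).integrable_mul (memLp_U hα h)

/-- Conservation of energy: in terms of the function u represented by the truncated g, the product
is (1/2)∫ u_x u^{p+1}, and u_x u^{p+1} is the derivative of u^{p+2}/(p+2). The cutoff supplies a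
classical derivative in `L²`, which a general element of H^{α/2} lacks. -/
theorem inner_nl_npow_cut (hα : 1 < α) (p n : ℕ) {g : L2} (hg : g ∈ realSubmodule) :
    ⟪mulOp (cut n) g, mulOp (nl α) (npow α p (mulOp (cut n) g))⟫_ℂ = 0 := by
  set h := mulOp (cut n) g
  set d := mulOp (dcut n) g
  set N := npow α p h
  have hh : h ∈ realSubmodule := mulOp_mem_realSubmodule (bddSymbol_cut n) (conj_cut_neg n) hg
  have hd : d ∈ realSubmodule := mulOp_mem_realSubmodule (bddSymbol_dcut n) (conj_dcut_neg n) hg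
  -- Plancherel: the two factors `kap` produce the denominator of `nl`, and conj(2πiξ) = 2·(-iπξ)
  -- gives the factor 1/2.
  have h1 : ⟪h, mulOp (nl α) N⟫_ℂ = 1 / 2 * ∫ x, conj (U α d x) * U α N x := by
    rw [integral_conj_U_mul_U hα, L2.inner_def, ← integral_const_mul]
    apply integral_congr_ae
    filter_upwards [coeFn_mulOp (bddSymbol_dcut n) g, coeFn_mulOp (bddSymbol_cut n) g,
      coeFn_mulOp (bddSymbol_nl hα) N] with ξ e1 e2 e3
    rw [RCLike.inner_apply, e1, e2, e3, dcut, nl]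
    have hk : kap α ξ * kap α ξ = ((wt α ξ)⁻¹ : ℝ) := by
      rw [kap, ← Complex.ofReal_mul, ← mul_inv, rwt_mul_self]
    simp only [map_mul, conj_kap, Complex.conj_ofReal, Complex.conj_I, Complex.conj_ofNat]
    calc _ = -(Real.pi * ξ * Complex.I) * ((wt α ξ)⁻¹ : ℝ) * conj (cut n ξ) * conj (g ξ) * N ξ := by
          push_cast; ring
      _ = _ := by rw [← hk]; ring
  have h2 : ∀ x, HasDerivAt (fun x => U α h x ^ (p + 2))
      ((p + 2) * (conj (U α d x) * U α N x)) x := by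
    intro x
    have h3 := (hasDerivAt_U_cut hα n g x).pow (p + 2)
    have e : ((p + 2 : ℕ) : ℂ) * U α h x ^ (p + 2 - 1) * U α d x
        = (p + 2) * (conj (U α d x) * U α N x) := by
      rw [conj_U hd, U_npow hα, show p + 2 - 1 = p + 1 from rfl]
      push_cast; ring
    rw [← e]
    exact h3
  have h4 : Integrable fun x => ((p + 2 : ℂ)) * (conj (U α d x) * U α N x) := by
    simp only [conj_U hd]
    exact (integrable_U_mul_U hα d N).const_mul _
  -- The power is a product of two `L²` functions, u and u^{p+1}.
  have h5 : Integrable fun x => U α h x ^ (p + 2) := by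
    refine (integrable_U_mul_U hα h N).congr (ae_of_all _ fun x => ?_)
    simp only [N, U_npow hα]; ring
  have h6 := integral_eq_zero_of_hasDerivAt_of_integrable h2 h4 h5
  rw [integral_const_mul] at h6
  have h7 : ((p : ℂ) + 2) ≠ 0 := by exact_mod_cast (by omega : p + 2 ≠ 0)
  rw [h1, (mul_eq_zero.1 h6).resolve_left h7, mul_zero]

/-- The cutoffs converge strongly to the identity and the expression is continuous in g. -/
theorem inner_nl_npow (hα : 1 < α) (p : ℕ) {g : L2} (hg : g ∈ realSubmodule) :
    ⟪g, mulOp (nl α) (npow α p g)⟫_ℂ = 0 := by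
  have hc : Continuous fun g : L2 => ⟪g, mulOp (nl α) (npow α p g)⟫_ℂ :=
    continuous_id.inner ((mulOp (nl α)).continuous.comp (continuous_npow hα p))
  have h1 := (hc.tendsto g).comp (tendsto_cut g)
  refine tendsto_nhds_unique h1 (tendsto_const_nhds.congr fun n => ?_)
  exact (inner_nl_npow_cut hα p n hg).symm

/-! ### The equation in the interaction picture -/

/-- The vector field of the equation for `w = e^{i t θ} g`. -/
def field (α : ℝ) (p : ℕ) (t : ℝ) (w : L2) : L2 :=
  mulOp (osc (disp α) t) (mulOp (nl α) (npow α p (mulOp (osc (disp α) (-t)) w)))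

theorem continuous_field (hα : 1 < α) (p : ℕ) : Continuous fun q : ℝ × L2 => field α p q.1 q.2 := by
  have h := continuous_mulOp_osc (measurable_disp hα)
  have h1 : Continuous fun q : ℝ × L2 => mulOp (osc (disp α) (-q.1)) q.2 :=
    h.comp (continuous_fst.neg.prodMk continuous_snd)
  exact h.comp (continuous_fst.prodMk
    ((mulOp (nl α)).continuous.comp ((continuous_npow hα p).comp h1)))

theorem norm_mulOp_nl_le (hα : 1 < α) (g : L2) : ‖mulOp (nl α) g‖ ≤ ‖g‖ := by
  simpa using norm_mulOp_apply_le (bddSymbol_nl hα) (norm_nl_le hα) g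

theorem exists_field_lipschitz (hα : 1 < α) (p : ℕ) (R : ℝ) (hR : 0 ≤ R) :
    ∃ K, 0 ≤ K ∧ ∀ t x y, ‖x‖ ≤ R → ‖y‖ ≤ R → ‖field α p t x - field α p t y‖ ≤ K * ‖x - y‖ := by
  obtain ⟨K, hK, h⟩ := exists_npow_lipschitz hα p R hR
  have hm := measurable_disp hα
  refine ⟨K, hK, fun t x y hx hy => ?_⟩
  rw [field, field, ← map_sub, ← map_sub, norm_mulOp_osc hm]
  refine (norm_mulOp_nl_le hα _).trans ((h _ _ ?_ ?_).trans_eq ?_)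
  · rwa [norm_mulOp_osc hm]
  · rwa [norm_mulOp_osc hm]
  · rw [← map_sub, norm_mulOp_osc hm]

theorem exists_field_bound (hα : 1 < α) (p : ℕ) (R : ℝ) (hR : 0 ≤ R) :
    ∃ A, 0 ≤ A ∧ ∀ t x, ‖x‖ ≤ R → ‖field α p t x‖ ≤ A := by
  obtain ⟨A, hA, h⟩ := exists_npow_bound hα p R hR
  have hm := measurable_disp hα
  refine ⟨A, hA, fun t x hx => ?_⟩
  rw [field, norm_mulOp_osc hm]
  exact (norm_mulOp_nl_le hα _).trans (h _ (by rwa [norm_mulOp_osc hm]))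

theorem mulOp_osc_mem (hα : 1 < α) (t : ℝ) {g : L2} (hg : g ∈ realSubmodule) :
    mulOp (osc (disp α) t) g ∈ realSubmodule :=
  mulOp_mem_realSubmodule (bddSymbol_osc (measurable_disp hα) t) (conj_osc_neg t) hg

theorem field_mem (hα : 1 < α) (p : ℕ) (t : ℝ) {w : L2} (hw : w ∈ realSubmodule) :
    field α p t w ∈ realSubmodule := by
  refine mulOp_osc_mem hα t (mulOp_mem_realSubmodule (bddSymbol_nl hα) (fun ξ => ?_)
    (npow_mem_realSubmodule hα p (mulOp_osc_mem hα _ hw)))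
  rw [nl_neg, map_neg, conj_nl, neg_neg]

theorem inner_mulOp_osc (hα : 1 < α) (t : ℝ) (g h : L2) :
    ⟪mulOp (osc (disp α) t) g, h⟫_ℂ = ⟪g, mulOp (osc (disp α) (-t)) h⟫_ℂ := by
  rw [inner_mulOp_left (bddSymbol_osc (measurable_disp hα) t)]
  simp only [conj_osc]

theorem inner_field (hα : 1 < α) (p : ℕ) (t : ℝ) {w : L2} (hw : w ∈ realSubmodule) :
    ⟪w, field α p t w⟫_ℂ = 0 := by
  have h := inner_nl_npow hα p (mulOp_osc_mem hα (-t) hw)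
  rwa [inner_mulOp_osc hα, neg_neg] at h

/-- Polarization: both inner products are determined by the same norm. -/
theorem real_inner_eq_re_inner_L2 (g h : L2) : ⟪g, h⟫_ℝ = (⟪g, h⟫_ℂ).re := by
  rw [real_inner_eq_norm_add_mul_self_sub_norm_mul_self_sub_norm_mul_self_div_two]
  exact (re_inner_eq_norm_add_mul_self_sub_norm_mul_self_sub_norm_mul_self_div_two
    (𝕜 := ℂ) g h).symm

theorem exists_global_field_solution (hα : 1 < α) (p : ℕ) {w₀ : L2} (hw₀ : w₀ ∈ realSubmodule) :
    ∃ w : ℝ → L2, w 0 = w₀ ∧ (∀ t, w t ∈ realSubmodule) ∧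
      ∀ t ∈ Ici (0 : ℝ), HasDerivWithinAt w (field α p t (w t)) (Ici 0) t := by
  -- The equation is solved inside the closed real subspace, because the orthogonality relation is
  -- available only for real-valued functions.
  have : CompleteSpace realSubmodule := isClosed_realSubmodule.completeSpace_coe
  obtain ⟨w, h0, hd⟩ := exists_global_solution (E := realSubmodule)
    (f := fun t w => ⟨field α p t w, field_mem hα p t w.2⟩)
    (fun x => Continuous.subtype_mk ((continuous_field hα p).comp
      (continuous_id.prodMk continuous_const)) _)
    (fun R hR => by
      obtain ⟨K, hK, h⟩ := exists_field_lipschitz hα p R hR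
      exact ⟨K, hK, fun t x y hx hy => h t x y hx hy⟩)
    (fun R hR => by
      obtain ⟨A, hA, h⟩ := exists_field_bound hα p R hR
      exact ⟨A, hA, fun t x hx => h t x hx⟩)
    (fun t x => by
      have h := inner_field hα p t x.2
      have h2 := real_inner_eq_re_inner_L2 (x : L2) (field α p t x)
      rw [h] at h2
      exact h2) ⟨w₀, hw₀⟩
  refine ⟨fun t => w t, congrArg Subtype.val h0, fun t => (w t).2, fun t ht => ?_⟩
  exact (realSubmodule.subtypeL.hasFDerivAt.comp_hasDerivWithinAt t (hd t ht))

end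

section

variable {α : ℝ}

/-! ### Sobolev functions and their weighted Fourier transforms -/

/-- The quotient of the two equivalent weights of `H^{α/2}`. -/
def ratio (α ξ : ℝ) : ℝ := rwt α ξ / (1 + (2 * Real.pi * ξ) ^ 2) ^ (α / 2 / 2)

theorem japanese_pos (α ξ : ℝ) : 0 < (1 + (2 * Real.pi * ξ) ^ 2) ^ (α / 2 / 2) := by positivity

theorem japanese_sq (α ξ : ℝ) : ((1 + (2 * Real.pi * ξ) ^ 2) ^ (α / 2 / 2)) ^ 2
    = (1 + (2 * Real.pi * ξ) ^ 2) ^ (α / 2) := by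
  rw [← Real.rpow_natCast, ← Real.rpow_mul (by positivity)]
  congr 1; push_cast; ring

theorem sq_rpow_half (x : ℝ) : (x ^ 2) ^ (α / 2) = |x| ^ α := by
  rw [← sq_abs, ← Real.rpow_natCast, ← Real.rpow_mul (abs_nonneg x)]
  congr 1; push_cast; ring

theorem ratio_pos (α ξ : ℝ) : 0 < ratio α ξ := div_pos (rwt_pos α ξ) (japanese_pos α ξ)

theorem wt_le_japanese (hα : 1 < α) (ξ : ℝ) :
    wt α ξ ≤ 9 / 4 * (1 + (2 * Real.pi * ξ) ^ 2) ^ (α / 2) := by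
  have h1 : 1 ≤ (1 + (2 * Real.pi * ξ) ^ 2) ^ (α / 2) :=
    Real.one_le_rpow (by nlinarith [sq_nonneg (2 * Real.pi * ξ)]) (by linarith)
  have h2 : |2 * Real.pi * ξ| ^ α ≤ (1 + (2 * Real.pi * ξ) ^ 2) ^ (α / 2) := by
    rw [← sq_rpow_half]
    exact Real.rpow_le_rpow (sq_nonneg _) (by linarith) (by linarith)
  unfold wt; linarith

theorem japanese_le_wt (hα : 1 < α) (ξ : ℝ) :
    (1 + (2 * Real.pi * ξ) ^ 2) ^ (α / 2) ≤ 2 ^ (α / 2) * wt α ξ := by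
  set x := 2 * Real.pi * ξ
  have h1 : 1 + x ^ 2 ≤ 2 * max 1 (x ^ 2) := by
    linarith [le_max_left 1 (x ^ 2), le_max_right 1 (x ^ 2)]
  have h2 : (max 1 (x ^ 2)) ^ (α / 2) ≤ wt α ξ := by
    have h3 : wt α ξ = 1 + 5 / 4 * |x| ^ α := rfl
    have h4 : 0 ≤ |x| ^ α := by positivity
    rcases max_cases 1 (x ^ 2) with ⟨h, _⟩ | ⟨h, _⟩ <;> rw [h, h3]
    · rw [Real.one_rpow]; linarith
    · rw [sq_rpow_half]; linarith
  calc (1 + x ^ 2) ^ (α / 2) ≤ (2 * max 1 (x ^ 2)) ^ (α / 2) :=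
        Real.rpow_le_rpow (by positivity) h1 (by linarith)
    _ = 2 ^ (α / 2) * (max 1 (x ^ 2)) ^ (α / 2) := Real.mul_rpow (by norm_num) (by positivity)
    _ ≤ _ := by gcongr

theorem measurable_ratio (hα : 1 < α) : Measurable (ratio α) := by
  have := (continuous_rwt hα).measurable
  unfold ratio; fun_prop

theorem bddSymbol_ratio (hα : 1 < α) : BddSymbol fun ξ => (ratio α ξ : ℂ) := by
  refine ⟨by have := measurable_ratio hα; fun_prop, 3 / 2, fun ξ => ?_⟩
  rw [Complex.norm_real, Real.norm_of_nonneg (ratio_pos α ξ).le, ratio,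
    div_le_iff₀ (japanese_pos α ξ)]
  refine abs_le_of_sq_le_sq' ?_ (by positivity) |>.2
  rw [mul_pow, japanese_sq, sq (rwt α ξ), rwt_mul_self]
  linarith [wt_le_japanese hα ξ]

theorem bddSymbol_ratio_inv (hα : 1 < α) : BddSymbol fun ξ => ((ratio α ξ)⁻¹ : ℂ) := by
  refine ⟨by have := measurable_ratio hα; fun_prop, Real.sqrt (2 ^ (α / 2)), fun ξ => ?_⟩
  rw [← Complex.ofReal_inv, Complex.norm_real, Real.norm_of_nonneg (inv_nonneg.2 (ratio_pos α ξ).le),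
    ratio, inv_div, div_le_iff₀ (rwt_pos α ξ)]
  refine abs_le_of_sq_le_sq' ?_ (mul_nonneg (Real.sqrt_nonneg _) (rwt_pos α ξ).le) |>.2
  rw [mul_pow (Real.sqrt _), japanese_sq, sq (rwt α ξ), rwt_mul_self, Real.sq_sqrt (by positivity)]
  exact japanese_le_wt hα ξ

/-- The function `(1 + (5/4) |2πξ|^α)^{1/2} û`. -/
def ofSob (u : Sobolev (α / 2)) : L2 := mulOp (fun ξ => (ratio α ξ : ℂ)) (Sobolev.weighted _ u)

theorem ofSob_sub (u v : Sobolev (α / 2)) : ofSob (u - v) = ofSob u - ofSob v := by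
  rw [ofSob, map_sub, map_sub]; rfl

theorem coeFn_ofSob (hα : 1 < α) (u : Sobolev (α / 2)) :
    ofSob u =ᵐ[volume] fun ξ => (rwt α ξ : ℂ) * fourierL2 u.toL2 ξ := by
  have h : Sobolev.weighted _ u =ᵐ[volume] weightedFourier (α / 2) u.toL2 :=
    u.memLp_weightedFourier.coeFn_toLp
  filter_upwards [coeFn_mulOp (bddSymbol_ratio hα) (Sobolev.weighted _ u), h] with ξ h1 h2
  have h3 : ((1 + (2 * Real.pi * ξ) ^ 2) ^ (α / 2 / 2) : ℝ) ≠ 0 := (japanese_pos α ξ).ne'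
  rw [ofSob, h1, h2, weightedFourier, ratio, ← mul_assoc, ← Complex.ofReal_mul, div_mul_cancel₀ _ h3]

theorem mulOp_kap_ofSob (hα : 1 < α) (u : Sobolev (α / 2)) :
    mulOp (kap α) (ofSob u) = fourierL2 u.toL2 := by
  refine mulOp_ext (bddSymbol_kap hα) ?_
  filter_upwards [coeFn_ofSob hα u] with ξ h
  rw [h, ← mul_assoc, mul_comm (kap α ξ), rwt_mul_kap, one_mul]

theorem norm_ofSob_le (hα : 1 < α) : ∃ C, ∀ u : Sobolev (α / 2), ‖ofSob u‖ ≤ C * ‖u‖ :=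
  ⟨_, fun _ => norm_mulOp_apply_le (bddSymbol_ratio hα) (bddSymbol_ratio hα).bound.choose_spec _⟩

theorem norm_le_ofSob (hα : 1 < α) : ∃ C, ∀ u : Sobolev (α / 2), ‖u‖ ≤ C * ‖ofSob u‖ := by
  obtain ⟨C, hC⟩ := (bddSymbol_ratio_inv hα).bound
  refine ⟨C, fun u => ?_⟩
  have h := norm_mulOp_apply_le (bddSymbol_ratio_inv hα) hC (ofSob u)
  rw [ofSob, mulOp_mulOp (bddSymbol_ratio_inv hα) (bddSymbol_ratio hα)] at h
  have h1 : ∀ ξ, ((ratio α ξ : ℂ))⁻¹ * (ratio α ξ : ℂ) = 1 := fun ξ =>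
    inv_mul_cancel₀ (Complex.ofReal_ne_zero.2 (ratio_pos α ξ).ne')
  simp only [h1, mulOp_one] at h
  exact h

theorem ofSob_injective (hα : 1 < α) : Function.Injective (ofSob (α := α)) := by
  intro u v h
  obtain ⟨C, hC⟩ := norm_le_ofSob hα
  have h1 := hC (u - v)
  rw [ofSob_sub, h, sub_self, norm_zero, mul_zero] at h1
  exact sub_eq_zero.1 (norm_le_zero_iff.1 h1)

theorem continuous_ofSob (hα : 1 < α) : Continuous (ofSob (α := α)) := by
  obtain ⟨C, hC⟩ := norm_ofSob_le hα
  refine (LipschitzWith.of_dist_le_mul (K := C.toNNReal) fun u v => ?_).continuous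
  rw [dist_eq_norm, dist_eq_norm, ← ofSob_sub]
  refine (hC _).trans (mul_le_mul_of_nonneg_right (Real.le_coe_toNNReal C) (norm_nonneg _))

theorem continuousOn_of_ofSob (hα : 1 < α) {u : ℝ → Sobolev (α / 2)} {s : Set ℝ}
    (h : ContinuousOn (fun t => ofSob (u t)) s) : ContinuousOn u s := by
  obtain ⟨C, hC⟩ := norm_le_ofSob hα
  intro t ht
  rw [ContinuousWithinAt, tendsto_iff_norm_sub_tendsto_zero]
  have h1 := tendsto_iff_norm_sub_tendsto_zero.1 (h t ht)
  refine squeeze_zero (fun _ => norm_nonneg _) (fun τ => hC (u τ - u t)) ?_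
  simpa only [ofSob_sub, mul_zero] using h1.const_mul C

theorem U_ofSob_ae (hα : 1 < α) (u : Sobolev (α / 2)) :
    U α (ofSob u) =ᵐ[volume] fun x => (u.toL2 x : ℂ) := by
  have h1 := toLp_U hα (ofSob u)
  rw [mulOp_kap_ofSob hα, fourierL2, FourierTransform.fourierInv_fourier_eq] at h1
  have h2 := (memLp_U hα (ofSob u)).coeFn_toLp
  rw [h1] at h2
  exact h2.symm.trans (Complex.ofRealCLM.coeFn_compLp u.toL2)

theorem ofSob_mem (hα : 1 < α) (u : Sobolev (α / 2)) : ofSob u ∈ realSubmodule := by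
  refine U_ae_injective hα ?_
  filter_upwards [U_ofSob_ae hα u] with x h
  rw [U_refl, h, Complex.conj_ofReal]

/-- The function represented by g equals its own real part, so that real part is the required
Sobolev function; the equivalence of the two weights gives its regularity. -/
theorem exists_ofSob_eq (hα : 1 < α) {g : L2} (hg : g ∈ realSubmodule) :
    ∃ u : Sobolev (α / 2), ofSob u = g := by
  set f : Lp ℝ 2 (volume : Measure ℝ) := ((memLp_U hα g).re).toLp _
  have h1 : Complex.ofRealCLM.compLp f = (𝓕⁻ (mulOp (kap α) g) : L2) := by
    rw [← toLp_U hα]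
    apply Lp.ext
    filter_upwards [Complex.ofRealCLM.coeFn_compLp f, ((memLp_U hα g).re).coeFn_toLp,
      (memLp_U hα g).coeFn_toLp] with x h1 h2 h3
    rw [h1, h2, h3]
    exact Complex.conj_eq_iff_re.1 (conj_U hg x)
  have h2 : fourierL2 f = mulOp (kap α) g := by
    rw [fourierL2, h1, FourierTransform.fourier_fourierInv_eq]
  have hk : ∀ ξ, (((1 + (2 * Real.pi * ξ) ^ 2) ^ (α / 2 / 2) : ℝ) : ℂ) * kap α ξ
      = (ratio α ξ : ℂ)⁻¹ := fun ξ => by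
    rw [kap, ← Complex.ofReal_mul, ← Complex.ofReal_inv, ratio, inv_div,
      div_eq_mul_inv _ (rwt α ξ)]
  have h3 : MemLp (weightedFourier (α / 2) f) 2 volume := by
    refine (memLp_congr_ae ?_).2 ((bddSymbol_ratio_inv hα).memLp g)
    filter_upwards [coeFn_mulOp (bddSymbol_kap hα) g] with ξ h
    rw [weightedFourier, h2, h, ← mul_assoc, hk]
  let u : Sobolev (α / 2) := ⟨f, h3⟩
  refine ⟨u, mulOp_injective (bddSymbol_kap hα) (kap_ne_zero α) ?_⟩
  rw [mulOp_kap_ofSob hα, ← h2]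
  rfl

/-! ### Test functions -/

/-- Measurable symbols of polynomial growth. -/
structure PolySymbol (a : ℝ → ℂ) : Prop where
  measurable : Measurable a
  bound : ∃ C : ℝ, ∃ k : ℕ, ∀ ξ, ‖a ξ‖ ≤ C * (1 + ξ ^ 2) ^ k

variable {a c : ℝ → ℂ}

theorem PolySymbol.of_le (ha : PolySymbol a) (hc : Measurable c) (C : ℝ)
    (h : ∀ ξ, ‖c ξ‖ ≤ C * ‖a ξ‖) : PolySymbol c := by
  obtain ⟨A, k, hA⟩ := ha.bound
  refine ⟨hc, |C| * A, k, fun ξ => (h ξ).trans ?_⟩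
  calc C * ‖a ξ‖ ≤ |C| * ‖a ξ‖ := by gcongr; exact le_abs_self C
    _ ≤ |C| * (A * (1 + ξ ^ 2) ^ k) := by gcongr; exact hA ξ
    _ = _ := by ring

theorem PolySymbol.mul (ha : PolySymbol a) (hc : PolySymbol c) :
    PolySymbol fun ξ => a ξ * c ξ := by
  obtain ⟨A, k, hA⟩ := ha.bound
  obtain ⟨B, l, hB⟩ := hc.bound
  refine ⟨ha.measurable.mul hc.measurable, A * B, k + l, fun ξ => ?_⟩
  rw [norm_mul, pow_add]
  calc _ ≤ (A * (1 + ξ ^ 2) ^ k) * (B * (1 + ξ ^ 2) ^ l) :=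
        mul_le_mul (hA ξ) (hB ξ) (norm_nonneg _) ((norm_nonneg _).trans (hA ξ))
    _ = _ := by ring

theorem BddSymbol.poly (ha : BddSymbol a) : PolySymbol a := by
  obtain ⟨C, hC⟩ := ha.bound
  exact ⟨ha.measurable, C, 0, fun ξ => by simpa using hC ξ⟩

theorem PolySymbol.add (ha : PolySymbol a) (hc : PolySymbol c) :
    PolySymbol fun ξ => a ξ + c ξ := by
  obtain ⟨A, k, hA⟩ := ha.bound
  obtain ⟨B, l, hB⟩ := hc.bound
  refine ⟨ha.measurable.add hc.measurable, |A| + |B|, k + l, fun ξ => (norm_add_le _ _).trans ?_⟩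
  have h1 : 1 ≤ 1 + ξ ^ 2 := by nlinarith [sq_nonneg ξ]
  have h2 : (1 + ξ ^ 2) ^ k ≤ (1 + ξ ^ 2) ^ (k + l) := pow_le_pow_right₀ h1 (by omega)
  have h3 : (1 + ξ ^ 2) ^ l ≤ (1 + ξ ^ 2) ^ (k + l) := pow_le_pow_right₀ h1 (by omega)
  calc _ ≤ A * (1 + ξ ^ 2) ^ k + B * (1 + ξ ^ 2) ^ l := add_le_add (hA ξ) (hB ξ)
    _ ≤ |A| * (1 + ξ ^ 2) ^ k + |B| * (1 + ξ ^ 2) ^ l := by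
        gcongr
        · exact le_abs_self A
        · exact le_abs_self B
    _ ≤ |A| * (1 + ξ ^ 2) ^ (k + l) + |B| * (1 + ξ ^ 2) ^ (k + l) := by gcongr
    _ = _ := by ring

theorem polySymbol_const (z : ℂ) : PolySymbol fun _ => z :=
  ⟨measurable_const, ‖z‖, 0, fun ξ => by simp⟩

theorem polySymbol_wt (hα : 1 < α) : PolySymbol fun ξ => (wt α ξ : ℂ) := by
  obtain ⟨k, hk⟩ := exists_nat_ge (α / 2)
  refine ⟨by have := measurable_wt hα; fun_prop, 9 / 4 * (1 + (2 * Real.pi) ^ 2) ^ k, k,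
    fun ξ => ?_⟩
  rw [Complex.norm_real, Real.norm_of_nonneg (wt_pos α ξ).le, mul_assoc, ← mul_pow]
  refine (wt_le_japanese hα ξ).trans ?_
  gcongr
  rw [← Real.rpow_natCast _ k]
  have h1 : 1 ≤ 1 + (2 * Real.pi * ξ) ^ 2 := by nlinarith [sq_nonneg (2 * Real.pi * ξ)]
  refine (Real.rpow_le_rpow_of_exponent_le h1 hk).trans
    (Real.rpow_le_rpow (by positivity) ?_ (Nat.cast_nonneg k))
  nlinarith [sq_nonneg (2 * Real.pi), sq_nonneg ξ]

theorem polySymbol_rwt (hα : 1 < α) : PolySymbol fun ξ => (rwt α ξ : ℂ) :=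
  (polySymbol_wt hα).of_le (by have := (continuous_rwt hα).measurable; fun_prop) 1 fun ξ => by
    rw [Complex.norm_real, Complex.norm_real, Real.norm_of_nonneg (wt_pos α ξ).le,
      Real.norm_of_nonneg (rwt_pos α ξ).le, one_mul, ← rwt_mul_self]
    exact le_mul_of_one_le_left (rwt_pos α ξ).le (one_le_rwt α ξ)

theorem polySymbol_abs_rpow (hα : 1 < α) :
    PolySymbol fun ξ => ((|2 * Real.pi * ξ| ^ α : ℝ) : ℂ) :=
  (polySymbol_wt hα).of_le (by have := (continuous_abs_rpow hα).measurable; fun_prop) 1 fun ξ => by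
    have h : 0 ≤ |2 * Real.pi * ξ| ^ α := by positivity
    rw [Complex.norm_real, Complex.norm_real, Real.norm_of_nonneg (wt_pos α ξ).le,
      Real.norm_of_nonneg h, wt]
    linarith

theorem polySymbol_deriv : PolySymbol fun ξ : ℝ => (2 * Real.pi * Complex.I * ξ : ℂ) := by
  refine ⟨by fun_prop, 2 * Real.pi, 1, fun ξ => ?_⟩
  simp only [norm_mul, Complex.norm_I, Complex.norm_real, mul_one, Complex.norm_ofNat, pow_one,
    Real.norm_eq_abs, abs_of_pos Real.pi_pos]
  have := Real.pi_pos
  gcongr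
  nlinarith [sq_abs ξ, sq_nonneg (|ξ| - 1)]

theorem abs_disp_le (hα : 1 < α) (ξ : ℝ) : |disp α ξ| ≤ wt α ξ := by
  refine le_trans ?_ (abs_le_wt hα ξ)
  have h : 0 ≤ |2 * Real.pi * ξ| ^ α := by positivity
  rw [disp, abs_div, abs_of_pos (wt_pos α ξ), div_le_iff₀ (wt_pos α ξ), abs_mul]
  gcongr
  rw [abs_of_nonneg (by positivity), wt]
  linarith

theorem polySymbol_disp (hα : 1 < α) : PolySymbol fun ξ => (disp α ξ : ℂ) :=
  (polySymbol_wt hα).of_le (by have := measurable_disp hα; fun_prop) 1 fun ξ => by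
    rw [Complex.norm_real, Complex.norm_real, Real.norm_of_nonneg (wt_pos α ξ).le, one_mul]
    exact abs_disp_le hα ξ

/-- The growth is moved onto the Schwartz factor: (1 + ξ²)^k ψ is again a Schwartz function. -/
theorem PolySymbol.eq_bounded_mul (ha : PolySymbol a) (ψ : 𝓢(ℝ, ℂ)) :
    ∃ (b : ℝ → ℂ) (C : ℝ) (χ : 𝓢(ℝ, ℂ)), Measurable b ∧ (∀ ξ, ‖b ξ‖ ≤ C) ∧
      ∀ ξ, a ξ * ψ ξ = b ξ * χ ξ := by
  obtain ⟨C, k, hC⟩ := ha.bound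
  have hg : (fun ξ : ℝ => ((1 + ξ ^ 2) ^ k : ℂ)).HasTemperateGrowth := by fun_prop
  refine ⟨fun ξ => a ξ / ((1 + ξ ^ 2 : ℝ) : ℂ) ^ k, C,
    SchwartzMap.smulLeftCLM ℂ (fun ξ : ℝ => ((1 + ξ ^ 2) ^ k : ℂ)) ψ,
    by have := ha.measurable; fun_prop, fun ξ => ?_, fun ξ => ?_⟩
  · have h1 : 0 < 1 + ξ ^ 2 := by positivity
    rw [norm_div, norm_pow, Complex.norm_real, Real.norm_of_nonneg h1.le,
      div_le_iff₀ (by positivity)]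
    exact hC ξ
  · rw [SchwartzMap.smulLeftCLM_apply_apply hg]
    have h1 : ((1 + ξ ^ 2 : ℝ) : ℂ) ≠ 0 := Complex.ofReal_ne_zero.2 (by positivity)
    simp only [smul_eq_mul]
    push_cast at h1 ⊢
    field_simp

theorem PolySymbol.integrable_mul (ha : PolySymbol a) (ψ : 𝓢(ℝ, ℂ)) :
    Integrable fun ξ => a ξ * ψ ξ := by
  obtain ⟨b, C, χ, hb, hC, h⟩ := ha.eq_bounded_mul ψ
  simp only [h]
  exact χ.integrable.bdd_mul hb.aestronglyMeasurable (ae_of_all _ hC)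

theorem PolySymbol.memLp_mul (ha : PolySymbol a) (ψ : 𝓢(ℝ, ℂ)) :
    MemLp (fun ξ => a ξ * ψ ξ) 2 volume := by
  obtain ⟨b, C, χ, hb, hC, h⟩ := ha.eq_bounded_mul ψ
  simp only [h]
  exact memLp_mul_of_bound hb hC (χ.memLp 2 volume)

open Classical in
/-- The function `a φ̂` of `L²` for a symbol `a` of polynomial growth. -/
def sch (a : ℝ → ℂ) (φ : 𝓢(ℝ, ℂ)) : L2 :=
  if ha : PolySymbol a then (ha.memLp_mul (𝓕 φ)).toLp _ else 0

theorem coeFn_sch (ha : PolySymbol a) (φ : 𝓢(ℝ, ℂ)) :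
    sch a φ =ᵐ[volume] fun ξ => a ξ * 𝓕 (φ : ℝ → ℂ) ξ := by
  rw [sch, dif_pos ha]
  exact MemLp.coeFn_toLp _

theorem mulOp_sch (hc : BddSymbol c) (ha : PolySymbol a) (φ : 𝓢(ℝ, ℂ)) :
    mulOp c (sch a φ) = sch (fun ξ => c ξ * a ξ) φ := by
  refine mulOp_ext hc ?_
  filter_upwards [coeFn_sch ha φ, coeFn_sch (hc.poly.mul ha) φ] with ξ h1 h2
  rw [h1, h2, mul_assoc]

/-- Plancherel. The integrand carries no conjugate because `U α g` is real, and the weight `kap`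
passes from g to the test function. -/
theorem integral_U_mul_fourierInv (hα : 1 < α) {g : L2} (hg : g ∈ realSubmodule)
    (ha : PolySymbol a) (hc : PolySymbol c) (h : ∀ ξ, kap α ξ * a ξ = c ξ) (φ : 𝓢(ℝ, ℂ)) :
    ∫ x, U α g x * 𝓕⁻ (fun ξ => a ξ * 𝓕 (φ : ℝ → ℂ) ξ) x = ⟪g, sch c φ⟫_ℂ := by
  have h1 := integral_conj_fourierInv_mul (integrable_kap_mul hα g) (memLp_kap_mul hα g)
    (ha.integrable_mul (𝓕 φ)) (ha.memLp_mul (𝓕 φ))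
  have h2 : ∀ x, conj (𝓕⁻ (fun ξ => kap α ξ * g ξ) x) = U α g x := conj_U hg
  simp only [h2] at h1
  refine h1.trans ?_
  rw [L2.inner_def]
  apply integral_congr_ae
  filter_upwards [coeFn_sch hc φ] with ξ e
  rw [RCLike.inner_apply, e, ← h, map_mul, conj_kap, SchwartzMap.fourier_coe]
  ring

end

section

variable {α : ℝ} {a c : ℝ → ℂ}

/-! ### The weak formulation on the Fourier side -/

theorem fourierInv_const_mul (z : ℂ) (f : ℝ → ℂ) (x : ℝ) :
    𝓕⁻ (fun ξ => z * f ξ) x = z * 𝓕⁻ f x := by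
  rw [Real.fourierInv_eq', Real.fourierInv_eq', ← integral_const_mul]
  congr 1; ext v
  simp only [smul_eq_mul]; ring

theorem schwartz_eq_fourierInv (φ : 𝓢(ℝ, ℂ)) (x : ℝ) : φ x = 𝓕⁻ (𝓕 (φ : ℝ → ℂ)) x := by
  have h : 𝓕⁻ (𝓕 φ) = φ := FourierTransform.fourierInv_fourier_eq φ
  have h2 := DFunLike.congr_fun h x
  rw [SchwartzMap.fourierInv_coe, SchwartzMap.fourier_coe] at h2
  exact h2.symm

theorem fourier_derivCLM (φ : 𝓢(ℝ, ℂ)) (ξ : ℝ) :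
    𝓕 (SchwartzMap.derivCLM ℂ ℂ φ : ℝ → ℂ) ξ = 2 * Real.pi * Complex.I * ξ * 𝓕 (φ : ℝ → ℂ) ξ := by
  have h1 : (SchwartzMap.derivCLM ℂ ℂ φ : ℝ → ℂ) = deriv φ := funext fun x => rfl
  have h2 : Integrable (deriv (φ : ℝ → ℂ)) := h1 ▸ (SchwartzMap.derivCLM ℂ ℂ φ).integrable
  rw [h1, Real.fourier_deriv φ.integrable φ.differentiable h2]
  simp

theorem test_eq_fourierInv (hα : 1 < α) (φ : 𝓢(ℝ, ℂ)) (x : ℝ) :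
    φ x + 5 / 4 * fracD α φ x = 𝓕⁻ (fun ξ => (wt α ξ : ℂ) * 𝓕 (φ : ℝ → ℂ) ξ) x := by
  have h1 := (polySymbol_const 1).integrable_mul (𝓕 φ)
  have h2 := ((polySymbol_abs_rpow hα).integrable_mul (𝓕 φ)).const_mul (5 / 4)
  rw [fracD, ← fourierInv_const_mul, schwartz_eq_fourierInv φ x]
  simp only [one_mul] at h1
  rw [SchwartzMap.fourier_coe] at h1 h2
  rw [← fourierInv_add_apply h1 h2]
  refine congrArg (fun f : ℝ → ℂ => (𝓕⁻ f : ℝ → ℂ) x) (funext fun ξ => ?_)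
  rw [wt]; push_cast; ring

theorem integral_test (hα : 1 < α) (u : Sobolev (α / 2)) (φ : 𝓢(ℝ, ℂ)) :
    ∫ x, (u.toL2 x : ℂ) * (φ x + 5 / 4 * fracD α φ x)
      = ⟪ofSob u, sch (fun ξ => (rwt α ξ : ℂ)) φ⟫_ℂ := by
  rw [← integral_U_mul_fourierInv hα (ofSob_mem hα u) (polySymbol_wt hα) (polySymbol_rwt hα)
    (fun ξ => by rw [← rwt_mul_self, Complex.ofReal_mul, ← mul_assoc, mul_comm (kap α ξ),
      rwt_mul_kap, one_mul]) φ]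
  apply integral_congr_ae
  filter_upwards [U_ofSob_ae hα u] with x h
  rw [h, test_eq_fourierInv hα]

theorem sch_add (ha : PolySymbol a) (hc : PolySymbol c) (φ : 𝓢(ℝ, ℂ)) :
    sch (fun ξ => a ξ + c ξ) φ = sch a φ + sch c φ := by
  apply Lp.ext
  filter_upwards [coeFn_sch ha φ, coeFn_sch hc φ, coeFn_sch (ha.add hc) φ,
    Lp.coeFn_add (sch a φ) (sch c φ)] with ξ h1 h2 h3 h4
  rw [h3, h4, Pi.add_apply, h1, h2, add_mul]

theorem sch_const_mul (z : ℂ) (ha : PolySymbol a) (φ : 𝓢(ℝ, ℂ)) :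
    sch (fun ξ => z * a ξ) φ = z • sch a φ := by
  apply Lp.ext
  filter_upwards [coeFn_sch ha φ, coeFn_sch ((polySymbol_const z).mul ha) φ,
    Lp.coeFn_smul z (sch a φ)] with ξ h1 h2 h3
  rw [h2, h3, Pi.smul_apply, h1, smul_eq_mul, mul_assoc]

/-- The weak right-hand side is that of g_t = -iθg + νN(g): the conjugate-linear pairing turns the
symbol iθ on the test function into -iθ on g. -/
theorem integral_rhs (hα : 1 < α) (p : ℕ) (u : Sobolev (α / 2)) (φ : 𝓢(ℝ, ℂ)) :
    (∫ x, ((u.toL2 x : ℂ) + 1 / 2 * (u.toL2 x : ℂ) ^ (p + 1)) * deriv φ x)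
        + 3 / 4 * ∫ x, (u.toL2 x : ℂ) * fracD α (SchwartzMap.derivCLM ℂ ℂ φ) x
      = ⟪ofSob u, sch (fun ξ => Complex.I * disp α ξ * (rwt α ξ : ℂ)) φ⟫_ℂ
        + ⟪mulOp (nl α) (npow α p (ofSob u)), sch (fun ξ => (rwt α ξ : ℂ)) φ⟫_ℂ := by
  set g := ofSob u
  set N := npow α p g
  set D : ℝ → ℂ := fun ξ => 2 * Real.pi * Complex.I * ξ
  set A : ℝ → ℂ := fun ξ => ((|2 * Real.pi * ξ| ^ α : ℝ) : ℂ)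
  have hg : g ∈ realSubmodule := ofSob_mem hα u
  have hN : N ∈ realSubmodule := npow_mem_realSubmodule hα p hg
  have hU := U_ofSob_ae hα u
  have hD : PolySymbol D := polySymbol_deriv
  have hA : PolySymbol A := polySymbol_abs_rpow hα
  have hk : PolySymbol (kap α) := (bddSymbol_kap hα).poly
  have i1 : ∫ x, ((u.toL2 x : ℂ) + 1 / 2 * (u.toL2 x : ℂ) ^ (p + 1)) * deriv φ x
      = ⟪g, sch (fun ξ => kap α ξ * D ξ) φ⟫_ℂ
        + 1 / 2 * ⟪N, sch (fun ξ => kap α ξ * D ξ) φ⟫_ℂ := by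
    have hm : g + (1 / 2 : ℝ) • N ∈ realSubmodule :=
      realSubmodule.add_mem hg (realSubmodule.smul_mem _ hN)
    have e1 := integral_U_mul_fourierInv hα hm hD (hk.mul hD) (fun _ => rfl) φ
    have e2 : (1 / 2 : ℝ) • N = (1 / 2 : ℂ) • N := by
      rw [← algebraMap_smul ℂ (1 / 2 : ℝ) N]; simp
    have e3 : ∀ x, U α ((1 / 2 : ℝ) • N) x = 1 / 2 * U α N x := by
      intro x
      rw [U, U, ← fourierInv_const_mul]
      apply Real.fourierInv_congr_ae
      filter_upwards [Lp.coeFn_smul (1 / 2 : ℝ) N] with ξ h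
      rw [h, Pi.smul_apply, Complex.real_smul]; push_cast; ring
    have e4 : ⟪g + (1 / 2 : ℝ) • N, sch (fun ξ => kap α ξ * D ξ) φ⟫_ℂ
        = ⟪g, sch (fun ξ => kap α ξ * D ξ) φ⟫_ℂ
        + 1 / 2 * ⟪N, sch (fun ξ => kap α ξ * D ξ) φ⟫_ℂ := by
      rw [inner_add_left, e2, inner_smul_left]; simp [Complex.conj_ofNat]
    rw [← e4, ← e1]
    apply integral_congr_ae
    filter_upwards [hU] with x h
    rw [U_add hα, e3, U_npow hα, h]
    congr 1
    have e5 : deriv φ x = SchwartzMap.derivCLM ℂ ℂ φ x := rfl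
    rw [e5, schwartz_eq_fourierInv]
    refine congrArg (fun f : ℝ → ℂ => (𝓕⁻ f : ℝ → ℂ) x) (funext fun ξ => ?_)
    rw [fourier_derivCLM]
  have i2 : ∫ x, (u.toL2 x : ℂ) * fracD α (SchwartzMap.derivCLM ℂ ℂ φ) x
      = ⟪g, sch (fun ξ => kap α ξ * (A ξ * D ξ)) φ⟫_ℂ := by
    rw [← integral_U_mul_fourierInv hα hg (hA.mul hD) (hk.mul (hA.mul hD)) (fun _ => rfl) φ]
    apply integral_congr_ae
    filter_upwards [hU] with x h
    rw [h, fracD]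
    refine congrArg (fun f : ℝ → ℂ => (u.toL2 x : ℂ) * (𝓕⁻ f : ℝ → ℂ) x) (funext fun ξ => ?_)
    rw [fourier_derivCLM, ← mul_assoc]
  have hkr : ∀ ξ, kap α ξ * (wt α ξ : ℂ) = rwt α ξ := fun ξ => by
    rw [← rwt_mul_self, Complex.ofReal_mul, ← mul_assoc, mul_comm (kap α ξ), rwt_mul_kap, one_mul]
  -- Since `kap` · `wt` = `rwt`, the denominator of the dispersion relation cancels and 2πiξ(1 +
  -- (3/4)|2πξ|^α) `kap` remains.
  have i3 : sch (fun ξ => Complex.I * disp α ξ * (rwt α ξ : ℂ)) φ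
      = sch (fun ξ => kap α ξ * D ξ) φ + (3 / 4 : ℂ) • sch (fun ξ => kap α ξ * (A ξ * D ξ)) φ := by
    rw [← sch_const_mul _ (hk.mul (hA.mul hD)),
      ← sch_add (hk.mul hD) ((polySymbol_const _).mul (hk.mul (hA.mul hD)))]
    congr 1; ext ξ
    have hw : (wt α ξ : ℂ) ≠ 0 := Complex.ofReal_ne_zero.2 (wt_pos α ξ).ne'
    rw [← hkr, disp]
    simp only [D, A]
    push_cast
    field_simp
  -- The conjugate of `nl` is its negative, and -`nl` · `rwt` = (1/2) `kap` · 2πiξ.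
  have i4 : ⟪mulOp (nl α) N, sch (fun ξ => (rwt α ξ : ℂ)) φ⟫_ℂ
      = 1 / 2 * ⟪N, sch (fun ξ => kap α ξ * D ξ) φ⟫_ℂ := by
    rw [inner_mulOp_left (bddSymbol_nl hα), mulOp_sch (bddSymbol_nl hα).conj (polySymbol_rwt hα),
      ← inner_smul_right, ← sch_const_mul _ (hk.mul hD)]
    congr 2; ext ξ
    have hw : (wt α ξ : ℂ) ≠ 0 := Complex.ofReal_ne_zero.2 (wt_pos α ξ).ne'
    rw [conj_nl, ← hkr, nl]
    simp only [D]
    push_cast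
    field_simp
  rw [i1, i2, i3, i4, inner_add_right, inner_smul_right]
  ring

/-! ### The damping factor -/

/-- The damping factor `1 / (1 + θ²)`. -/
def damp (α ξ : ℝ) : ℂ := ((1 + disp α ξ ^ 2)⁻¹ : ℝ)

theorem damp_ne_zero (α ξ : ℝ) : damp α ξ ≠ 0 :=
  Complex.ofReal_ne_zero.2 (inv_ne_zero (by positivity))

theorem norm_damp (α ξ : ℝ) : ‖damp α ξ‖ = (1 + disp α ξ ^ 2)⁻¹ := by
  rw [damp, Complex.norm_real, Real.norm_of_nonneg (by positivity)]

theorem bddSymbol_damp (hα : 1 < α) : BddSymbol (damp α) :=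
  ⟨by have := measurable_disp hα; unfold damp; fun_prop, 1, fun ξ => by
    rw [norm_damp]; exact inv_le_one_of_one_le₀ (by nlinarith [sq_nonneg (disp α ξ)])⟩

theorem conj_damp (α ξ : ℝ) : conj (damp α ξ) = damp α ξ := Complex.conj_ofReal _

theorem damp_mul (α ξ : ℝ) : damp α ξ * (1 + disp α ξ ^ 2 : ℝ) = 1 := by
  rw [damp, ← Complex.ofReal_mul, inv_mul_cancel₀ (by positivity), Complex.ofReal_one]

theorem bddSymbol_disp_damp (hα : 1 < α) : BddSymbol fun ξ => Complex.I * disp α ξ * damp α ξ := by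
  refine ⟨by
    have := measurable_disp hα
    have := (bddSymbol_damp hα).measurable
    fun_prop, 1, fun ξ => ?_⟩
  rw [norm_mul, norm_mul, Complex.norm_I, one_mul, norm_damp, Complex.norm_real, Real.norm_eq_abs,
    ← div_eq_mul_inv, div_le_one (by positivity)]
  nlinarith [sq_abs (disp α ξ), sq_nonneg (|disp α ξ| - 1)]

theorem hasDerivAt_damped (hα : 1 < α) (t : ℝ) :
    HasDerivAt (fun τ => mulOp (fun ξ => osc (disp α) τ ξ * damp α ξ))
      (mulOp fun ξ => Complex.I * disp α ξ * (osc (disp α) t ξ * damp α ξ)) t := by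
  refine hasDerivAt_mulOp_osc (measurable_disp hα) (bddSymbol_damp hα) (C := 1) (fun ξ => ?_) t ?_
  · rw [norm_damp, inv_mul_le_iff₀ (by positivity)]; linarith
  · have h := (bddSymbol_osc (measurable_disp hα) t).mul (bddSymbol_disp_damp hα)
    convert h using 2
    ring

theorem polySymbol_undamp (hα : 1 < α) :
    PolySymbol fun ξ => ((1 + disp α ξ ^ 2 : ℝ) : ℂ) * (rwt α ξ : ℂ) := by
  have h := ((polySymbol_const 1).add ((polySymbol_disp hα).mul (polySymbol_disp hα))).mul
    (polySymbol_rwt hα)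
  convert h using 3
  push_cast; ring

/-- The damped test function `(1 + θ²) (1 + (5/4) |2πξ|^α)^{1/2} φ̂`. -/
def test (α : ℝ) (φ : 𝓢(ℝ, ℂ)) : L2 :=
  sch (fun ξ => ((1 + disp α ξ ^ 2 : ℝ) : ℂ) * (rwt α ξ : ℂ)) φ

theorem mulOp_damp_test (hα : 1 < α) {b : ℝ → ℂ} (hb : BddSymbol fun ξ => b ξ * damp α ξ)
    (φ : 𝓢(ℝ, ℂ)) :
    mulOp (fun ξ => b ξ * damp α ξ) (test α φ) = sch (fun ξ => b ξ * (rwt α ξ : ℂ)) φ := by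
  rw [test, mulOp_sch hb (polySymbol_undamp hα)]
  congr 1; ext ξ
  calc _ = b ξ * (damp α ξ * (1 + disp α ξ ^ 2 : ℝ)) * rwt α ξ := by ring
    _ = _ := by rw [damp_mul, mul_one]

/-- Taking φ to be the inverse transform of an arbitrary smooth compactly supported function shows
that q · conj g vanishes almost everywhere, and the continuous factor q has no zero. -/
theorem eq_zero_of_inner_test (hα : 1 < α) {g : L2} (h : ∀ φ, ⟪g, test α φ⟫_ℂ = 0) : g = 0 := by
  set q : ℝ → ℂ := fun ξ => ((1 + disp α ξ ^ 2 : ℝ) : ℂ) * (rwt α ξ : ℂ)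
  have hq : Continuous q := by
    have h1 := continuous_disp hα
    have h2 := continuous_rwt hα
    simp only [q]; fun_prop
  have hgl : LocallyIntegrable (fun ξ => conj (g ξ)) := by
    have h1 : LocallyIntegrable g := (Lp.memLp g).locallyIntegrable (by norm_num)
    refine h1.mono (Complex.continuous_conj.comp_aestronglyMeasurable h1.aestronglyMeasurable)
      (ae_of_all _ fun ξ => by simp)
  have h0 := ae_eq_zero_of_integral_contDiff_smul_eq_zero (hgl.continuous_mul hq) ?_
  · apply Lp.ext
    filter_upwards [h0, Lp.coeFn_zero ℂ 2 (volume : Measure ℝ)] with ξ h1 h2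
    have hq0 : q ξ ≠ 0 := mul_ne_zero (Complex.ofReal_ne_zero.2 (by positivity)) (rwt_ne_zero α ξ)
    rw [h2, Pi.zero_apply]
    simpa [hq0] using h1
  · intro f hf hfc
    have hf₁ : HasCompactSupport (Complex.ofRealCLM ∘ f) := hfc.comp_left rfl
    have hf₂ : ContDiff ℝ ((⊤ : ℕ∞) : WithTop ℕ∞) (Complex.ofRealCLM ∘ f) := by fun_prop
    set ψ : 𝓢(ℝ, ℂ) := hf₁.toSchwartzMap hf₂
    have hψ : ∀ x, ψ x = (f x : ℂ) := fun x => rfl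
    rw [← h (𝓕⁻ ψ), L2.inner_def]
    apply integral_congr_ae
    filter_upwards [coeFn_sch (polySymbol_undamp hα) (𝓕⁻ ψ)] with ξ h1
    rw [RCLike.inner_apply, test, h1, ← SchwartzMap.fourier_coe,
      FourierTransform.fourier_fourierInv_eq, hψ, Complex.real_smul]
    ring

end

/-! ### From damped curves back to solutions. -/

section

variable {α : ℝ}

theorem hasDerivWithinAt_damped_apply (hα : 1 < α) {K : ℝ → L2} {K' : L2} {s : Set ℝ} {t : ℝ}
    (hK : HasDerivWithinAt K K' s t) :
    HasDerivWithinAt (fun τ => mulOp (fun ξ => osc (disp α) τ ξ * damp α ξ) (K τ))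
      (mulOp (fun ξ => Complex.I * disp α ξ * (osc (disp α) t ξ * damp α ξ)) (K t)
        + mulOp (fun ξ => osc (disp α) t ξ * damp α ξ) K') s t := by
  have h1 : HasDerivWithinAt
      (fun τ => (mulOp (fun ξ => osc (disp α) τ ξ * damp α ξ)).restrictScalars ℝ)
      ((mulOp fun ξ => Complex.I * disp α ξ * (osc (disp α) t ξ * damp α ξ)).restrictScalars ℝ)
      s t :=
    (ContinuousLinearMap.restrictScalarsL ℂ L2 L2 ℝ ℝ).hasFDerivAt.comp_hasDerivWithinAt t
      (hasDerivAt_damped hα t).hasDerivWithinAt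
  exact h1.clm_apply hK

/-! ### Existence -/

/-- Moves the group from the curve to the test vector. There the damping, compensated by `test`,
makes it differentiable, while e^{-itθ}w(t) itself need not be. -/
theorem inner_osc_sch (hα : 1 < α) (t : ℝ) (w : L2) {b : ℝ → ℂ}
    (hb : BddSymbol fun ξ => b ξ * damp α ξ) (φ : 𝓢(ℝ, ℂ)) :
    ⟪w, mulOp (fun ξ => b ξ * (osc (disp α) t ξ * damp α ξ)) (test α φ)⟫_ℂ
      = ⟪mulOp (osc (disp α) (-t)) w, sch (fun ξ => b ξ * (rwt α ξ : ℂ)) φ⟫_ℂ := by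
  rw [inner_mulOp_osc hα, neg_neg, ← mulOp_damp_test hα hb,
    mulOp_mulOp (bddSymbol_osc (measurable_disp hα) t) hb]
  congr 3; ext ξ; ring

theorem exists_solution (hα : 1 < α) (p : ℕ) (u₀ : Sobolev (α / 2)) :
    ∃ u : ℝ → Sobolev (α / 2), IsSolutionOn α p u₀ (Ici 0) u := by
  obtain ⟨w, h0, hmem, hd⟩ := exists_global_field_solution hα p (ofSob_mem hα u₀)
  have hm := measurable_disp hα
  choose u hu using fun t => exists_ofSob_eq hα (mulOp_osc_mem hα (-t) (hmem t))
  refine ⟨u, ⟨?_, ?_, fun φ t ht => ?_⟩⟩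
  · refine continuousOn_of_ofSob hα ?_
    have hw : ContinuousOn w (Ici 0) := fun t ht => (hd t ht).continuousWithinAt
    have hp : ContinuousOn (fun t : ℝ => (-t, w t)) (Ici 0) := continuousOn_id.neg.prodMk hw
    refine ((continuous_mulOp_osc hm).comp_continuousOn hp).congr fun t _ => ?_
    exact hu t
  · apply ofSob_injective hα
    rw [hu, h0, neg_zero]
    have : osc (disp α) 0 = fun _ => 1 := funext fun ξ => osc_zero _ ξ
    rw [this, mulOp_one]
  · simp only [integral_test hα, integral_rhs hα]
    have hb1 : BddSymbol fun ξ => (1 : ℂ) * damp α ξ := by simpa using bddSymbol_damp hα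
    have e1 : ∀ τ (x : L2), ⟪mulOp (osc (disp α) (-τ)) x, sch (fun ξ => (rwt α ξ : ℂ)) φ⟫_ℂ
        = ⟪x, mulOp (fun ξ => osc (disp α) τ ξ * damp α ξ) (test α φ)⟫_ℂ := fun τ x => by
      simpa using (inner_osc_sch hα τ x hb1 φ).symm
    have h1 := hasDerivWithinAt_damped_apply hα (hasDerivWithinAt_const t (Ici 0) (test α φ))
    -- The derivative falling on the group gives the linear terms of the equation; the one falling
    -- on w gives the nonlinear term.
    have h2 := (hd t ht).inner ℂ h1
    simp only [map_zero, add_zero] at h2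
    simp only [hu, e1]
    refine h2.congr_deriv ?_
    rw [inner_osc_sch hα t (w t) (bddSymbol_disp_damp hα), ← e1]
    rw [field, mulOp_mulOp (bddSymbol_osc hm _) (bddSymbol_osc hm _)]
    simp only [osc_neg_mul_osc, mulOp_one]

/-! ### Uniqueness -/

/-- A continuous curve whose images under a separating family of operators are differentiable
is differentiable. -/
theorem hasDerivWithinAt_of_separating {E F ι : Type*} [NormedAddCommGroup E] [NormedSpace ℝ E]
    [CompleteSpace E] [NormedAddCommGroup F] [NormedSpace ℝ F] (ℓ : ι → E →L[ℝ] F)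
    (hℓ : ∀ x, (∀ i, ℓ i x = 0) → x = 0) {w f : ℝ → E} {T : ℝ} (hw : ContinuousOn w (Ico 0 T))
    (hf : ContinuousOn f (Ico 0 T))
    (hd : ∀ i, ∀ t ∈ Ico 0 T, HasDerivWithinAt (fun τ => ℓ i (w τ)) (ℓ i (f t)) (Ico 0 T) t) :
    ∀ t ∈ Ico 0 T, HasDerivWithinAt w (f t) (Ico 0 T) t := by
  intro t ht
  obtain ⟨S, htS, hST⟩ := exists_between ht.2
  have hS0 : 0 ≤ S := ht.1.trans htS.le
  have hsub : Icc 0 S ⊆ Ico 0 T := fun x hx => ⟨hx.1, hx.2.trans_lt hST⟩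
  -- A continuous extension of f from [0, S] to the line, so that its primitive is differentiable
  -- everywhere.
  set q : ℝ → E := fun τ => f (projIcc 0 S hS0 τ)
  have hq : Continuous q :=
    (hf.mono hsub).comp_continuous (continuous_subtype_val.comp continuous_projIcc)
      fun τ => (projIcc 0 S hS0 τ).2
  have hqf : ∀ τ ∈ Icc 0 S, q τ = f τ := fun τ hτ => by simp only [q, projIcc_of_mem hS0 hτ]
  set I : ℝ → E := fun τ => ∫ s in (0 : ℝ)..τ, q s
  have hI : ∀ τ, HasDerivAt I (q τ) τ := fun τ => hq.integral_hasStrictDerivAt 0 τ |>.hasDerivAt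
  -- Under each functional, w minus the primitive has right derivative zero and is constant;
  -- separation makes this an identity of vectors.
  have key : ∀ τ ∈ Icc 0 S, w τ = w 0 + I τ := by
    intro τ hτ
    rw [← sub_eq_zero]
    refine hℓ _ fun i => ?_
    have hZ : ∀ s ∈ Icc 0 S, ℓ i (w s) - ℓ i (I s) = ℓ i (w 0) - ℓ i (I 0) := by
      refine constant_of_has_deriv_right_zero ?_ fun s hs => ?_
      · refine ContinuousOn.sub ((ℓ i).continuous.comp_continuousOn (hw.mono hsub)) ?_
        exact ((ℓ i).continuous.comp
          (continuous_iff_continuousAt.2 fun τ => (hI τ).continuousAt)).continuousOn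
      · have hs' := Ico_subset_Icc_self hs
        have h1 : HasDerivWithinAt (fun τ => ℓ i (w τ)) (ℓ i (f s)) (Ici s) s :=
          (hd i s (hsub hs')).mono_of_mem_nhdsWithin
            (mem_of_superset (Icc_mem_nhdsGE_of_mem hs) hsub)
        have h2 : HasDerivWithinAt (fun s => ℓ i (I s)) (ℓ i (q s)) (Ici s) s :=
          (ℓ i).hasFDerivAt.comp_hasDerivWithinAt s (hI s).hasDerivWithinAt
        have h3 := h1.sub h2
        rwa [hqf s hs', sub_self] at h3
    have h4 := hZ τ hτ
    have h5 : I 0 = 0 := intervalIntegral.integral_same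
    rw [h5, map_zero, sub_zero] at h4
    rw [map_sub, map_add, ← h4]
    abel
  have htI : t ∈ Icc 0 S := ⟨ht.1, htS.le⟩
  have h6 : HasDerivWithinAt w (f t) (Icc 0 S) t := by
    have h7 := ((hI t).const_add (w 0)).hasDerivWithinAt (s := Icc 0 S)
    rw [hqf t htI] at h7
    exact h7.congr key (key t htI)
  refine h6.mono_of_mem_nhdsWithin ?_
  have h8 : Iio S ∩ Ico 0 T ⊆ Icc 0 S := fun x hx => ⟨hx.2.1, hx.1.le⟩
  exact mem_of_superset (inter_mem (mem_nhdsWithin_of_mem_nhds (Iio_mem_nhds htS))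
    self_mem_nhdsWithin) h8

/-- The real-linear functional `x ↦ ⟪x, h⟫`. -/
def innerRight (h : L2) : L2 →L[ℝ] ℂ :=
  (Complex.conjCLE : ℂ →L[ℝ] ℂ) ∘L ((innerSL ℂ h).restrictScalars ℝ)

theorem innerRight_apply (h x : L2) : innerRight h x = ⟪x, h⟫_ℂ :=
  inner_conj_symm (𝕜 := ℂ) x h

theorem inner_sch_eq_damp (hα : 1 < α) (φ : 𝓢(ℝ, ℂ)) (x : L2) :
    ⟪x, sch (fun ξ => (rwt α ξ : ℂ)) φ⟫_ℂ = ⟪mulOp (damp α) x, test α φ⟫_ℂ := by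
  have hk := bddSymbol_damp hα
  rw [inner_mulOp_left hk]
  have := mulOp_damp_test hα (b := fun _ => 1) (by simpa using hk) φ
  simp only [one_mul] at this
  simp only [conj_damp]
  rw [← this]

/-- The sign appears because multiplication by iθ/(1+θ²) is skew-adjoint. -/
theorem inner_sch_disp_eq_damp (hα : 1 < α) (φ : 𝓢(ℝ, ℂ)) (x : L2) :
    ⟪x, sch (fun ξ => Complex.I * disp α ξ * (rwt α ξ : ℂ)) φ⟫_ℂ
      = -⟪mulOp (fun ξ => Complex.I * disp α ξ * damp α ξ) x, test α φ⟫_ℂ := by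
  have hkd := bddSymbol_disp_damp hα
  rw [inner_mulOp_left hkd, ← mulOp_damp_test hα hkd, ← inner_neg_right]
  congr 1
  refine mulOp_ext hkd ?_
  filter_upwards [coeFn_mulOp hkd.conj (test α φ),
    Lp.coeFn_neg (mulOp (fun ξ => conj (Complex.I * disp α ξ * damp α ξ)) (test α φ))]
    with ξ h1 h2
  rw [h2, Pi.neg_apply, h1]
  simp [conj_damp]

/-- The strong form of the equation, after damping. -/
theorem IsSolutionOn.hasDerivWithinAt_damp (hα : 1 < α) {p : ℕ} {u₀ : Sobolev (α / 2)} {T : ℝ}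
    {v : ℝ → Sobolev (α / 2)} (hv : IsSolutionOn α p u₀ (Ico 0 T) v) :
    ∀ t ∈ Ico 0 T, HasDerivWithinAt (fun τ => mulOp (damp α) (ofSob (v τ)))
      (mulOp (damp α) (mulOp (nl α) (npow α p (ofSob (v t))))
        - mulOp (fun ξ => Complex.I * disp α ξ * damp α ξ) (ofSob (v t))) (Ico 0 T) t := by
  have hg : ContinuousOn (fun τ => ofSob (v τ)) (Ico 0 T) :=
    (continuous_ofSob hα).comp_continuousOn hv.continuousOn
  have hB : ContinuousOn (fun τ => mulOp (nl α) (npow α p (ofSob (v τ)))) (Ico 0 T) :=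
    ((mulOp (nl α)).continuous.comp (continuous_npow hα p)).comp_continuousOn hg
  refine hasDerivWithinAt_of_separating (fun φ : 𝓢(ℝ, ℂ) => innerRight (test α φ))
    (fun x hx => eq_zero_of_inner_test hα fun φ => by rw [← innerRight_apply]; exact hx φ)
    ((mulOp (damp α)).continuous.comp_continuousOn hg)
    (((mulOp (damp α)).continuous.comp_continuousOn hB).sub
      ((mulOp _).continuous.comp_continuousOn hg)) fun φ t ht => ?_
  have h := hv.equation φ t ht
  simp only [integral_test hα, integral_rhs hα] at h
  simp only [innerRight_apply, inner_sub_left]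
  simp only [inner_sch_eq_damp hα, inner_sch_disp_eq_damp hα] at h
  refine h.congr_deriv ?_
  rw [add_comm, ← sub_eq_add_neg]

theorem mulOp_damp_damp_osc (hα : 1 < α) (τ : ℝ) (g : L2) :
    mulOp (fun ξ => damp α ξ * damp α ξ) (mulOp (osc (disp α) τ) g)
      = mulOp (fun ξ => osc (disp α) τ ξ * damp α ξ) (mulOp (damp α) g) := by
  have hm := bddSymbol_osc (measurable_disp hα) τ
  have hk := bddSymbol_damp hα
  rw [mulOp_mulOp (hm.mul hk) hk, mulOp_mulOp (hk.mul hk) hm]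
  congr 2; ext ξ; ring

/-- The term iθ from differentiating the group cancels the term -iθ of the equation; all the linear
multipliers commute. -/
theorem damped_field_eq (hα : 1 < α) (p : ℕ) (t : ℝ) (g : L2) :
    mulOp (fun ξ => Complex.I * disp α ξ * (osc (disp α) t ξ * damp α ξ)) (mulOp (damp α) g)
        + mulOp (fun ξ => osc (disp α) t ξ * damp α ξ) (mulOp (damp α) (mulOp (nl α) (npow α p g))
          - mulOp (fun ξ => Complex.I * disp α ξ * damp α ξ) g)
      = mulOp (fun ξ => damp α ξ * damp α ξ) (field α p t (mulOp (osc (disp α) t) g)) := by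
  have hm := bddSymbol_osc (measurable_disp hα)
  have hk := bddSymbol_damp hα
  have hkd := bddSymbol_disp_damp hα
  have hdok : BddSymbol fun ξ => Complex.I * disp α ξ * (osc (disp α) t ξ * damp α ξ) := by
    have h := (hm t).mul hkd
    convert h using 2
    ring
  have e1 : (fun ξ => Complex.I * disp α ξ * (osc (disp α) t ξ * damp α ξ) * damp α ξ)
      = fun ξ => osc (disp α) t ξ * damp α ξ * (Complex.I * disp α ξ * damp α ξ) := by
    ext ξ; ring
  rw [map_sub, ← mulOp_damp_damp_osc hα, mulOp_mulOp hdok hk, mulOp_mulOp ((hm t).mul hk) hkd,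
    field, mulOp_mulOp (hm _) (hm _), e1, add_sub_cancel]
  simp only [osc_neg_mul_osc, mulOp_one]

/-- One damping factor makes g differentiable, a second makes the group differentiable in norm, so
the product rule holds for the curve damped twice. The operator 1/(1+θ²)² is injective and is then
removed by the separation lemma, with a family of one member. -/
theorem IsSolutionOn.hasDerivWithinAt (hα : 1 < α) {p : ℕ} {u₀ : Sobolev (α / 2)} {T : ℝ}
    {v : ℝ → Sobolev (α / 2)} (hv : IsSolutionOn α p u₀ (Ico 0 T) v) :
    ∀ t ∈ Ico 0 T, HasDerivWithinAt (fun τ => mulOp (osc (disp α) τ) (ofSob (v τ)))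
      (field α p t (mulOp (osc (disp α) t) (ofSob (v t)))) (Ico 0 T) t := by
  have hm := measurable_disp hα
  have hk := bddSymbol_damp hα
  have hg : ContinuousOn (fun τ => ofSob (v τ)) (Ico 0 T) :=
    (continuous_ofSob hα).comp_continuousOn hv.continuousOn
  have hgp : ContinuousOn (fun τ => (τ, ofSob (v τ))) (Ico 0 T) := continuousOn_id.prodMk hg
  have hwc : ContinuousOn (fun τ => mulOp (osc (disp α) τ) (ofSob (v τ))) (Ico 0 T) :=
    ((continuous_mulOp_osc hm).comp_continuousOn hgp).congr fun _ _ => rfl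
  have hwp : ContinuousOn (fun τ => (τ, mulOp (osc (disp α) τ) (ofSob (v τ)))) (Ico 0 T) :=
    continuousOn_id.prodMk hwc
  have hfc : ContinuousOn (fun τ => field α p τ (mulOp (osc (disp α) τ) (ofSob (v τ)))) (Ico 0 T) :=
    ((continuous_field hα p).comp_continuousOn hwp).congr fun _ _ => rfl
  have hsep : ∀ x, (∀ _ : Unit, (mulOp fun ξ => damp α ξ * damp α ξ).restrictScalars ℝ x = 0) →
      x = 0 := fun x hx => by
    refine mulOp_injective (hk.mul hk)
      (fun ξ => mul_ne_zero (damp_ne_zero α ξ) (damp_ne_zero α ξ)) ?_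
    rw [map_zero]
    exact hx ()
  have hd : ∀ t ∈ Ico 0 T, HasDerivWithinAt (fun τ => (mulOp fun ξ => damp α ξ * damp α ξ)
      (mulOp (osc (disp α) τ) (ofSob (v τ)))) ((mulOp fun ξ => damp α ξ * damp α ξ)
      (field α p t (mulOp (osc (disp α) t) (ofSob (v t))))) (Ico 0 T) t := fun t ht => by
    have h := hasDerivWithinAt_damped_apply hα (hv.hasDerivWithinAt_damp hα t ht)
    simp only [mulOp_damp_damp_osc hα]
    rw [damped_field_eq hα] at h
    exact h
  exact hasDerivWithinAt_of_separating
    (fun _ : Unit => (mulOp fun ξ => damp α ξ * damp α ξ).restrictScalars ℝ) hsep hwc hfc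
    fun _ => hd

/-- In the interaction picture both curves solve the same differential equation. On [0, t] they stay
in a common ball by compactness, and on that ball the field is Lipschitz. -/
theorem IsSolutionOn.eqOn (hα : 1 < α) {p : ℕ} {u₀ : Sobolev (α / 2)} {T : ℝ}
    {u v : ℝ → Sobolev (α / 2)} (hu : IsSolutionOn α p u₀ (Ico 0 T) u)
    (hv : IsSolutionOn α p u₀ (Ico 0 T) v) : EqOn v u (Ico 0 T) := by
  intro t ht
  have hm := measurable_disp hα
  have hsub : Icc 0 t ⊆ Ico 0 T := fun x hx => ⟨hx.1, hx.2.trans_lt ht.2⟩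
  have du := hu.hasDerivWithinAt hα
  have dv := hv.hasDerivWithinAt hα
  set a : ℝ → L2 := fun τ => mulOp (osc (disp α) τ) (ofSob (u τ))
  set b : ℝ → L2 := fun τ => mulOp (osc (disp α) τ) (ofSob (v τ))
  have ca : ContinuousOn a (Icc 0 t) := fun s hs => (du s (hsub hs)).continuousWithinAt.mono hsub
  have cb : ContinuousOn b (Icc 0 t) := fun s hs => (dv s (hsub hs)).continuousWithinAt.mono hsub
  obtain ⟨A, hA⟩ := isCompact_Icc.exists_bound_of_continuousOn ca
  obtain ⟨B, hB⟩ := isCompact_Icc.exists_bound_of_continuousOn cb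
  obtain ⟨K, hK, hKl⟩ := exists_field_lipschitz hα p (max 0 (max A B)) (le_max_left _ _)
  have hd : ∀ {w : ℝ → L2} {w' : L2} {s : ℝ}, s ∈ Ico 0 t →
      HasDerivWithinAt w w' (Ico 0 T) s → HasDerivWithinAt w w' (Ici s) s := fun hs h =>
    h.mono_of_mem_nhdsWithin (mem_of_superset (Icc_mem_nhdsGE_of_mem hs) hsub)
  have h := ODE_solution_unique_of_mem_Icc_right (v := field α p) (K := K.toNNReal)
    (s := fun _ => Metric.closedBall 0 (max 0 (max A B)))
    (fun s _ => LipschitzOnWith.of_dist_le_mul fun x hx y hy => by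
      rw [dist_eq_norm, dist_eq_norm, Real.coe_toNNReal K hK]
      exact hKl s x y (by simpa using hx) (by simpa using hy))
    cb (fun s hs => hd hs (dv s (hsub (Ico_subset_Icc_self hs))))
    (fun s hs => mem_closedBall_zero_iff.2 ((hB s (Ico_subset_Icc_self hs)).trans
      ((le_max_right _ _).trans (le_max_right _ _))))
    ca (fun s hs => hd hs (du s (hsub (Ico_subset_Icc_self hs))))
    (fun s hs => mem_closedBall_zero_iff.2 ((hA s (Ico_subset_Icc_self hs)).trans
      ((le_max_left _ _).trans (le_max_right _ _))))
    (by simp only [a, b, hu.initial, hv.initial]) (right_mem_Icc.2 ht.1)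
  exact ofSob_injective hα (mulOp_injective (bddSymbol_osc hm t)
    (fun ξ => norm_ne_zero_iff.1 (by rw [norm_osc]; exact one_ne_zero)) h)

theorem IsSolutionOn.mono {α : ℝ} {p : ℕ} {r : ℝ} {u₀ : Sobolev r} {J J' : Set ℝ}
    {u : ℝ → Sobolev r} (h : IsSolutionOn α p u₀ J u) (hJ : J' ⊆ J) : IsSolutionOn α p u₀ J' u :=
  ⟨h.continuousOn.mono hJ, h.initial, fun φ t ht => (h.equation φ t (hJ ht)).mono hJ⟩

end

end GfBBM

end

theorem mainTheorem8 (α : ℝ) (hα : 1 < α) (p : ℕ) (u₀ : GfBBM.Sobolev (α / 2)) :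
    ∃ u : ℝ → GfBBM.Sobolev (α / 2),
      GfBBM.IsSolutionOn α p u₀ (Set.Ici 0) u ∧
      (∀ v : ℝ → GfBBM.Sobolev (α / 2),
        GfBBM.IsSolutionOn α p u₀ (Set.Ici 0) v → Set.EqOn v u (Set.Ici 0)) ∧
      ∀ T : ℝ, 0 < T → ∀ v : ℝ → GfBBM.Sobolev (α / 2),
        GfBBM.IsSolutionOn α p u₀ (Set.Ico 0 T) v → Set.EqOn v u (Set.Ico 0 T) := by
  obtain ⟨u, hu⟩ := GfBBM.exists_solution hα p u₀
  refine ⟨u, hu, fun v hv t ht => ?_, fun T _ v hv => ?_⟩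
  -- Equality at time t follows from uniqueness on the interval [0, t + 1).
  · exact (hu.mono Set.Ico_subset_Ici_self).eqOn hα (hv.mono Set.Ico_subset_Ici_self)
      ⟨ht, lt_add_one t⟩
  · exact (hu.mono Set.Ico_subset_Ici_self).eqOn hα hv
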